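/- Let $\mathbb K$ be a field and let $A=\bigoplus_{n\ge 0}A_n$ be an $\mathbb N$-graded $\mathbb K$-algebra that is connected ($A_0=\mathbb K$), locally finite ($\dim_{\mathbb K}A_n<\infty$ for all $n$) and generated in degree one. Suppose that $A$ is Artin–Schelter regular of dimension $d$, that is: 1. $A$ has finite (left) global dimension $d$; 2. $A$ is Gorenstein: for some integer $l$, the graded Ext groups $\underline{\mathrm{Ext}}^i_A(\mathbb K,A)=\bigoplus_{n\in\mathbb Z}\mathrm{Ext}^i_{\mathrm{gr}}(\mathbb K,A(n))$ of the trivial left module $\mathbb K=A/A_{\ge 1}$ vanish for $i\ne d$, and $\underline{\mathrm{Ext}}^d_A(\mathbb K,A)\cong\mathbb K(l)$, the trivial module placed in degree $-l$; 3. $A$ has finite Gelfand–Kirillov dimension, where $$\mathrm{GKdim}(A)=\sup_V\ \limsup_{n\to\infty}\frac{\log\dim_{\mathbb K}\left(V^0+V^1+\cdots+V^n\right)}{\log n},$$ the supremum being over all finite-dimensional subspaces $V\subseteq A$, with $V^0=\mathbb K\cdot 1$. Then $\mathrm{GKdim}(A)$ is a non-negative integer and $$\mathrm{GKdim}(A)\equiv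 d \pmod 2 .$$ -/

import Mathlib

universe u v

/-- Left global dimension of a ring: the supremum of the projective dimensions of all left modules
(`⊥` only for the zero ring). -/
noncomputable def globalDimension (A : Type u) [Ring A] : WithBot ℕ∞ :=
  ⨆ M : ModuleCat.{u} A, CategoryTheory.projectiveDimension M

/-- Gelfand-Kirillov dimension of a `K`-algebra: the supremum, over the finite-dimensional
subspaces `V`, of `limsup_n log (dim (V⁰ + V¹ + ⋯ + Vⁿ)) / log n`. -/
noncomputable def gkDim (K : Type v) (A : Type u) [Field K] [Ring A] [Algebra K A] : EReal :=
  ⨆ (V : Submodule K A) (_ : V.FG),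
    Filter.limsup
      (fun n : ℕ =>
        ((Real.log (Module.finrank K (⨆ i ∈ Finset.range (n + 1), V ^ i : Submodule K A)) /
          Real.log n : ℝ) : EReal))
      Filter.atTop

section Graded

variable {K : Type v} {A : Type u} [Field K] [Ring A] [Algebra K A]

/-- Connected: `A₀ = K`. -/
structure IsConnectedGraded (𝒜 : ℕ → Submodule K A) : Prop where
  nontrivial : Nontrivial A
  zero_eq_one : 𝒜 0 = 1

/-- Locally finite: every homogeneous component is finite-dimensional. -/
def IsLocallyFinite (𝒜 : ℕ → Submodule K A) : Prop :=
  ∀ n, Module.Finite K (𝒜 n)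

/-- Generated in degree one: `A₁` generates `A` as a `K`-algebra. -/
def IsGeneratedInDegreeOne (𝒜 : ℕ → Submodule K A) : Prop :=
  Algebra.adjoin K (𝒜 1 : Set A) = ⊤

/-- The components of `A` indexed by `ℤ`, zero in negative degrees. -/
def intComponent (𝒜 : ℕ → Submodule K A) : ℤ → Submodule K A
  | Int.ofNat n => 𝒜 n
  | Int.negSucc _ => ⊥

/-- The trivial left module `K = A / A₊`. It is concentrated in degree `0`. -/
abbrev TrivialModule (𝒜 : ℕ → Submodule K A) [GradedAlgebra 𝒜] : Type u :=
  A ⧸ (HomogeneousIdeal.irrelevant 𝒜).toIdeal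

/-- A resolution `⋯ ⟶ P₁ ⟶ P₀ ⟶ K ⟶ 0` of the trivial left module by `ℤ`-graded projective left
`A`-modules, all maps being `A`-linear and homogeneous of degree `0`. -/
structure GradedProjectiveResolution (𝒜 : ℕ → Submodule K A) [GradedAlgebra 𝒜] where
  P : ℕ → Type u
  [addCommGroup : ∀ i, AddCommGroup (P i)]
  [module : ∀ i, Module A (P i)]
  projective : ∀ i, Module.Projective A (P i)
  /-- `gr i j` is the homogeneous component of degree `j` of `P i`. -/
  gr : ∀ i, ℤ → AddSubgroup (P i)
  isInternal : ∀ i, DirectSum.IsInternal (gr i)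
  smul_mem : ∀ (i m : ℕ) (j : ℤ) (a : A) (x : P i), a ∈ 𝒜 m → x ∈ gr i j → a • x ∈ gr i (m + j)
  d : ∀ i, P (i + 1) →ₗ[A] P i
  d_mem : ∀ i j x, x ∈ gr (i + 1) j → d i x ∈ gr i j
  ε : P 0 →ₗ[A] TrivialModule 𝒜
  /-- `ε` has degree `0`: it kills the components of nonzero degree, as `K` lives in degree `0`. -/
  ε_eq_zero : ∀ j x, j ≠ 0 → x ∈ gr 0 j → ε x = 0
  exact_d : ∀ i, Function.Exact (d (i + 1)) (d i)
  exact_ε : Function.Exact (d 0) ε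
  surjective_ε : Function.Surjective ε

namespace GradedProjectiveResolution

variable {𝒜 : ℕ → Submodule K A} [GradedAlgebra 𝒜]

attribute [instance] GradedProjectiveResolution.addCommGroup GradedProjectiveResolution.module

variable (R : GradedProjectiveResolution 𝒜)

/-- `Hom_gr(P i, A(n))`, where `A(n)_j = A_{n+j}`: the `A`-linear maps `P i → A` of degree `n`. -/
def homDegree (i : ℕ) (n : ℤ) : Submodule K (R.P i →ₗ[A] A) where
  carrier := {f | ∀ j, ∀ x ∈ R.gr i j, f x ∈ intComponent 𝒜 (n + j)}
  add_mem' hf hg j x hx := add_mem (hf j x hx) (hg j x hx)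
  zero_mem' _ _ _ := zero_mem _
  smul_mem' c _ hf j x hx := Submodule.smul_mem _ c (hf j x hx)

/-- Precomposition with the differential, `Hom_A(P i, A) → Hom_A(P (i + 1), A)`. -/
def precomp (i : ℕ) : (R.P i →ₗ[A] A) →ₗ[K] (R.P (i + 1) →ₗ[A] A) where
  toFun f := f ∘ₗ R.d i
  map_add' _ _ := rfl
  map_smul' _ _ := rfl

/-- The cocycles of degree `n` in `Hom(P i, A)`. -/
def cocycles (i : ℕ) (n : ℤ) : Submodule K (R.P i →ₗ[A] A) :=
  R.homDegree i n ⊓ LinearMap.ker (R.precomp i)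

/-- The coboundaries of degree `n` in `Hom(P i, A)`. -/
def coboundaries : (i : ℕ) → ℤ → Submodule K (R.P i →ₗ[A] A)
  | 0, _ => ⊥
  | i + 1, n => (R.homDegree i n).map (R.precomp i)

theorem coboundaries_le_cocycles (i : ℕ) (n : ℤ) : R.coboundaries i n ≤ R.cocycles i n := by
  cases i with
  | zero => exact bot_le
  | succ i =>
    rintro _ ⟨g, hg, rfl⟩
    refine ⟨fun j x hx => hg j _ (R.d_mem i j x hx), ?_⟩
    refine LinearMap.mem_ker.mpr (LinearMap.ext fun x => ?_)
    change g (R.d i (R.d (i + 1) x)) = 0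
    rw [(R.exact_d i).apply_apply_eq_zero x, map_zero]

/-- The component of degree `n` of the graded Ext group `⨁ₙ Ext_gr^i(K, A(n))`, computed from the
resolution: the `i`-th cohomology of `Hom_gr(P, A(n))`, cocycles modulo coboundaries, as a subspace
of `Hom(P i, A)` modulo coboundaries. -/
abbrev extDegree (i : ℕ) (n : ℤ) : Submodule K ((R.P i →ₗ[A] A) ⧸ R.coboundaries i n) :=
  (R.cocycles i n).map (R.coboundaries i n).mkQ

end GradedProjectiveResolution

/-- The Gorenstein condition with AS-index `l`: the graded group `Ext^i_A(K, A)` is zero for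
`i ≠ d`, and `Ext^d_A(K, A)` is `K(l)`, i.e. one-dimensional and concentrated in degree `-l`
(such a graded module is necessarily trivial, since `A₊` raises degrees). As Ext does not depend
on the graded projective resolution of `K`, it may be computed from any of them. -/
def IsGorensteinWithIndex (𝒜 : ℕ → Submodule K A) [GradedAlgebra 𝒜] (d : ℕ) (l : ℤ) : Prop :=
  ∀ R : GradedProjectiveResolution 𝒜,
    (∀ (i : ℕ) (n : ℤ), ¬(i = d ∧ n = -l) → Subsingleton (R.extDegree i n)) ∧
      Nonempty (R.extDegree d (-l) ≃ₗ[K] K)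

/-- Artin-Schelter regular algebras of dimension `d`: connected, locally finite `ℕ`-graded algebras
generated in degree one, of global dimension `d` and of finite GK dimension, which satisfy the
Gorenstein condition. -/
structure IsArtinSchelterRegular (𝒜 : ℕ → Submodule K A) [GradedAlgebra 𝒜] (d : ℕ) : Prop where
  connected : IsConnectedGraded 𝒜
  locallyFinite : IsLocallyFinite 𝒜
  generatedInDegreeOne : IsGeneratedInDegreeOne 𝒜
  globalDimension_eq : globalDimension A = d
  gorenstein : ∃ l : ℤ, IsGorensteinWithIndex 𝒜 d l
  gkDim_lt_top : gkDim K A < ⊤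

end Graded

/-! The parity comes from a functional equation of the Hilbert series `H(t)` of `A`, and `GKdim` is
the order of its pole at `1`.

Take the minimal graded free resolution `P` of the trivial module. Finite global dimension makes it
stop at step `d` (`Z_eq_bot`, by a graded Nakayama argument). The Gorenstein condition bounds the
degrees of its generators by `l` (`deg_le`), so every term has finite rank. With `p(t)` the
alternating sum of `t ^ deg b` over the generators, the Euler characteristic of `P` gives `p * H =
1`. That of `Hom(P, A)`, whose cohomology is one line in position `d`, gives `t ^ M * p(1/t) * H =
(-1) ^ d * t ^ k`. Hence `p.reflect M = (-1) ^ d * X ^ k * p` (`exists_polynomial`).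

Finite `GKdim` gives the coefficients of `H` polynomial growth, so `H` converges on the open unit
disc and `p` has no zero there. The functional equation excludes zeros outside the closed disc and
makes the leading coefficient `±1`, so by Kronecker's theorem all zeros of `p` are roots of unity.
As `H` has nonnegative coefficients, none has multiplicity above the multiplicity `m` of the zero
`1` (`rootMultiplicity_le`). So `p` divides a power `(1 - X ^ N) ^ m`, which bounds the partial sums
of the coefficients of `H` by a multiple of `(n + 1) ^ m` (`exists_sum_le_mul_pow`). The behaviour
of `H(r)` as `r → 1` rules out any smaller exponent (`not_eventually_sum_le_rpow`). Since `A` is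
generated in degree one, these partial sums determine `GKdim`, which is therefore `m`. Comparing the
two sides of the functional equation at `1`, after removing `(X - 1) ^ m`, gives `(-1) ^ m = (-1) ^
d` (`modEq_rootMultiplicity`). -/

set_option linter.unusedSectionVars false

/-! ### Graded free modules and their homogeneous components. -/

section FreeGraded

theorem LinearMap.apply_eq_finsuppSum {A ι M : Type*} [Ring A] [AddCommGroup M] [Module A M]
    (f : (ι →₀ A) →ₗ[A] M) (x : ι →₀ A) :
    f x = x.sum fun b a => a • f (Finsupp.single b 1) := by
  conv_lhs => rw [← Finsupp.sum_single x]
  rw [map_finsuppSum]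
  refine Finsupp.sum_congr fun b _ => ?_
  rw [← map_smul, Finsupp.smul_single, smul_eq_mul, mul_one]

variable {K : Type v} {A : Type u} [Field K] [Ring A] [Algebra K A]

theorem intComponent_natCast (𝒜 : ℕ → Submodule K A) (n : ℕ) : intComponent 𝒜 (n : ℤ) = 𝒜 n := rfl

theorem intComponent_of_neg (𝒜 : ℕ → Submodule K A) {j : ℤ} (hj : j < 0) :
    intComponent 𝒜 j = ⊥ := by
  cases j with
  | ofNat n => exact absurd hj (by simp)
  | negSucc n => rfl

variable (𝒜 : ℕ → Submodule K A) [GradedAlgebra 𝒜]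

theorem mul_mem_intComponent {i j : ℤ} {a b : A} (ha : a ∈ intComponent 𝒜 i)
    (hb : b ∈ intComponent 𝒜 j) : a * b ∈ intComponent 𝒜 (i + j) := by
  rcases lt_or_ge i 0 with hi | hi
  · rw [intComponent_of_neg 𝒜 hi, Submodule.mem_bot] at ha
    simp [ha]
  rcases lt_or_ge j 0 with hj | hj
  · rw [intComponent_of_neg 𝒜 hj, Submodule.mem_bot] at hb
    simp [hb]
  lift i to ℕ using hi
  lift j to ℕ using hj
  exact SetLike.mul_mem_graded (A := 𝒜) ha hb

/-- The projection of `A` onto its component of integral degree `j`. -/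
noncomputable def intProj : ℤ → A →ₗ[K] A
  | Int.ofNat n => GradedAlgebra.proj 𝒜 n
  | Int.negSucc _ => 0

theorem intProj_mem (j : ℤ) (a : A) : intProj 𝒜 j a ∈ intComponent 𝒜 j := by
  cases j with
  | ofNat n => exact (DirectSum.decompose 𝒜 a n).2
  | negSucc n => exact zero_mem _

theorem intProj_of_mem {j : ℤ} {a : A} (ha : a ∈ intComponent 𝒜 j) : intProj 𝒜 j a = a := by
  cases j with
  | ofNat n => exact DirectSum.decompose_of_mem_same 𝒜 ha
  | negSucc n => exact ((Submodule.mem_bot K).1 ha).symm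

theorem intProj_of_mem_ne {i j : ℤ} (hij : i ≠ j) {a : A} (ha : a ∈ intComponent 𝒜 i) :
    intProj 𝒜 j a = 0 := by
  cases i with
  | negSucc n => rw [(Submodule.mem_bot K).1 ha, map_zero]
  | ofNat m =>
    cases j with
    | negSucc n => rfl
    | ofNat n => exact DirectSum.decompose_of_mem_ne 𝒜 ha (fun h => hij (by rw [h]))

theorem iSup_intComponent : ⨆ j, intComponent 𝒜 j = ⊤ := by
  rw [eq_top_iff, ← (DirectSum.Decomposition.isInternal 𝒜).submodule_iSup_eq_top]
  exact iSup_le fun n => le_iSup (intComponent 𝒜) (n : ℤ)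

variable {ι : Type*} (deg : ι → ℕ)

/-- The homogeneous component of degree `j` of the free module with basis `ι`, the basis vector `b`
having degree `deg b`. -/
def freeGr (j : ℤ) : Submodule K (ι →₀ A) where
  carrier := {x | ∀ b, x b ∈ intComponent 𝒜 (j - deg b)}
  add_mem' hx hy b := add_mem (hx b) (hy b)
  zero_mem' _ := zero_mem _
  smul_mem' c _ hx b := Submodule.smul_mem _ c (hx b)

/-- The projection of a graded free module onto its component of degree `j`. -/
noncomputable def freeProj (j : ℤ) : (ι →₀ A) →ₗ[K] (ι →₀ A) where
  toFun x := Finsupp.onFinset x.support (fun b => intProj 𝒜 (j - deg b) (x b)) fun b hb => by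
    rw [Finsupp.mem_support_iff]
    intro h
    exact hb (by rw [h, map_zero])
  map_add' x y := by ext b; simp
  map_smul' c x := by ext b; simp

variable {deg}

theorem freeProj_mem (j : ℤ) (x : ι →₀ A) : freeProj 𝒜 deg j x ∈ freeGr 𝒜 deg j :=
  fun _ => intProj_mem 𝒜 _ _

theorem freeProj_of_mem {j : ℤ} {x : ι →₀ A} (hx : x ∈ freeGr 𝒜 deg j) :
    freeProj 𝒜 deg j x = x := by
  ext b
  exact intProj_of_mem 𝒜 (hx b)

theorem freeProj_of_mem_ne {i j : ℤ} (hij : i ≠ j) {x : ι →₀ A} (hx : x ∈ freeGr 𝒜 deg i) :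
    freeProj 𝒜 deg j x = 0 := by
  ext b
  exact intProj_of_mem_ne 𝒜 (by simpa using hij) (hx b)

theorem freeGr_of_neg {j : ℤ} (hj : j < 0) : freeGr 𝒜 deg j = ⊥ := by
  rw [eq_bot_iff]
  intro x hx
  rw [Submodule.mem_bot]
  ext b
  have h := hx b
  rw [intComponent_of_neg 𝒜 (by omega : j - deg b < 0)] at h
  exact h

theorem smul_mem_freeGr {i j : ℤ} {a : A} {x : ι →₀ A} (ha : a ∈ intComponent 𝒜 i)
    (hx : x ∈ freeGr 𝒜 deg j) : a • x ∈ freeGr 𝒜 deg (i + j) := fun b => by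
  have := mul_mem_intComponent 𝒜 ha (hx b)
  rwa [← add_sub_assoc] at this

theorem single_mem_freeGr {j : ℤ} {a : A} {b : ι} (ha : a ∈ intComponent 𝒜 (j - deg b)) :
    Finsupp.single b a ∈ freeGr 𝒜 deg j := fun c => by
  classical
  rw [Finsupp.single_apply]
  split_ifs with h
  · rwa [← h]
  · exact zero_mem _

theorem one_mem_intComponent : (1 : A) ∈ intComponent 𝒜 0 :=
  SetLike.GradedOne.one_mem (A := 𝒜)

theorem basis_mem_freeGr (b : ι) : Finsupp.single b (1 : A) ∈ freeGr 𝒜 deg (deg b) :=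
  single_mem_freeGr 𝒜 (by rw [sub_self]; exact one_mem_intComponent 𝒜)

variable (deg) in
theorem iSup_freeGr : ⨆ j, freeGr 𝒜 deg j = ⊤ := by
  rw [eq_top_iff]
  rintro x -
  induction x using Finsupp.induction_linear with
  | zero => exact zero_mem _
  | add x y hx hy => exact add_mem hx hy
  | single b a =>
    have ha : a ∈ ⨆ j, intComponent 𝒜 j := by rw [iSup_intComponent]; trivial
    induction ha using Submodule.iSup_induction' with
    | zero => rw [Finsupp.single_zero]; exact zero_mem _
    | add x y _ _ hx hy => rw [Finsupp.single_add]; exact add_mem hx hy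
    | mem j a ha =>
      refine Submodule.mem_iSup_of_mem (j + deg b) (single_mem_freeGr 𝒜 ?_)
      rwa [add_sub_cancel_right]

variable (deg) in
theorem exists_sum_freeProj (x : ι →₀ A) : ∃ s : Finset ℤ, ∑ j ∈ s, freeProj 𝒜 deg j x = x := by
  classical
  suffices h : ∃ s : Finset ℤ, ∀ t, s ⊆ t → ∑ j ∈ t, freeProj 𝒜 deg j x = x from
    let ⟨s, hs⟩ := h
    ⟨s, hs s subset_rfl⟩
  have hx : x ∈ ⨆ j, freeGr 𝒜 deg j := by rw [iSup_freeGr]; trivial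
  induction hx using Submodule.iSup_induction' with
  | zero => exact ⟨∅, fun t _ => by simp⟩
  | add x y _ _ hx hy =>
    obtain ⟨s, hs⟩ := hx
    obtain ⟨t, ht⟩ := hy
    refine ⟨s ∪ t, fun r hr => ?_⟩
    simp only [map_add]
    rw [Finset.sum_add_distrib, hs r (Finset.union_subset_left hr),
      ht r (Finset.union_subset_right hr)]
  | mem j x hx =>
    refine ⟨{j}, fun t ht => ?_⟩
    rw [Finset.sum_eq_single j (fun i _ hi => freeProj_of_mem_ne 𝒜 hi.symm hx)
      (fun h => absurd (ht (Finset.mem_singleton_self j)) h), freeProj_of_mem 𝒜 hx]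

variable (deg) in
theorem isInternal_freeGr :
    DirectSum.IsInternal fun j : ℤ => (freeGr 𝒜 deg j).toAddSubgroup := by
  classical
  have key : ∀ (y : DirectSum ℤ fun j => (freeGr 𝒜 deg j).toAddSubgroup) (j : ℤ),
      freeProj 𝒜 deg j (DirectSum.coeAddMonoidHom _ y) = y j := by
    intro y j
    induction y using DirectSum.induction_on with
    | zero => simp
    | of i x =>
      rw [DirectSum.coeAddMonoidHom_of]
      by_cases hij : i = j
      · subst hij
        rw [freeProj_of_mem 𝒜 x.2, DirectSum.of_eq_same]
      · rw [freeProj_of_mem_ne 𝒜 hij x.2, DirectSum.of_eq_of_ne _ _ _ (Ne.symm hij)]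
        rfl
    | add x y hx hy => rw [map_add, map_add, hx, hy]; rfl
  constructor
  · rw [injective_iff_map_eq_zero]
    intro y hy
    refine DFinsupp.ext fun j => Subtype.ext ?_
    rw [← key y j, hy, map_zero]
    rfl
  · intro x
    obtain ⟨s, hs⟩ := exists_sum_freeProj 𝒜 deg x
    refine ⟨∑ j ∈ s, DirectSum.of (fun j : ℤ => (freeGr 𝒜 deg j).toAddSubgroup) j
      ⟨freeProj 𝒜 deg j x, freeProj_mem 𝒜 j x⟩, ?_⟩
    rw [map_sum]
    simpa only [DirectSum.coeAddMonoidHom_of] using hs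

/-- A map into a graded free module which sends basis vectors to homogeneous elements of the same
degree preserves degrees. -/
theorem map_mem_freeGr {κ : Type*} {deg' : κ → ℕ} (D : (κ →₀ A) →ₗ[A] (ι →₀ A))
    (hD : ∀ b, D (Finsupp.single b 1) ∈ freeGr 𝒜 deg (deg' b)) {j : ℤ} {x : κ →₀ A}
    (hx : x ∈ freeGr 𝒜 deg' j) : D x ∈ freeGr 𝒜 deg j := by
  rw [D.apply_eq_finsuppSum]
  refine sum_mem fun b _ => ?_
  have := smul_mem_freeGr 𝒜 (hx b) (hD b)
  rwa [sub_add_cancel] at this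

theorem map_freeProj {κ : Type*} {deg' : κ → ℕ} (D : (κ →₀ A) →ₗ[A] (ι →₀ A))
    (hD : ∀ b, D (Finsupp.single b 1) ∈ freeGr 𝒜 deg (deg' b)) (j : ℤ) (x : κ →₀ A) :
    D (freeProj 𝒜 deg' j x) = freeProj 𝒜 deg j (D x) := by
  have hx : x ∈ ⨆ j, freeGr 𝒜 deg' j := by rw [iSup_freeGr]; trivial
  induction hx using Submodule.iSup_induction' with
  | zero => simp
  | add x y _ _ hx hy => simp only [map_add, hx, hy]
  | mem i x hx =>
    by_cases hij : i = j
    · subst hij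
      rw [freeProj_of_mem 𝒜 hx, freeProj_of_mem 𝒜 (map_mem_freeGr 𝒜 D hD hx)]
    · rw [freeProj_of_mem_ne 𝒜 hij hx, freeProj_of_mem_ne 𝒜 hij (map_mem_freeGr 𝒜 D hD hx),
        map_zero]

theorem freeProj_smul {i : ℤ} {a : A} (ha : a ∈ intComponent 𝒜 i) (j : ℤ) (x : ι →₀ A) :
    freeProj 𝒜 deg (i + j) (a • x) = a • freeProj 𝒜 deg j x := by
  have hx : x ∈ ⨆ j, freeGr 𝒜 deg j := by rw [iSup_freeGr]; trivial
  induction hx using Submodule.iSup_induction' with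
  | zero => simp
  | add x y _ _ hx hy => simp only [map_add, smul_add, hx, hy]
  | mem k x hx =>
    by_cases hkj : k = j
    · subst hkj
      rw [freeProj_of_mem 𝒜 hx, freeProj_of_mem 𝒜 (smul_mem_freeGr 𝒜 ha hx)]
    · rw [freeProj_of_mem_ne 𝒜 hkj hx,
        freeProj_of_mem_ne 𝒜 (by simpa using hkj) (smul_mem_freeGr 𝒜 ha hx), smul_zero]

theorem finite_intComponent (h𝒜 : IsLocallyFinite 𝒜) (j : ℤ) :
    Module.Finite K (intComponent 𝒜 j) := by
  cases j with
  | ofNat n => exact h𝒜 n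
  | negSucc n => exact inferInstanceAs (Module.Finite K (⊥ : Submodule K A))

/-- Only the basis vectors of degree at most `j` contribute to the component of degree `j`, because
`A` has no negative degrees. -/
theorem finite_freeGr (h𝒜 : IsLocallyFinite 𝒜) (hdeg : ∀ n, {b | deg b = n}.Finite) (j : ℤ) :
    Module.Finite K (freeGr 𝒜 deg j) := by
  have hfin : {b | (deg b : ℤ) ≤ j}.Finite := by
    refine ((Set.finite_Iic j.toNat).biUnion fun n _ => hdeg n).subset fun b hb => ?_
    simp only [Set.mem_iUnion, Set.mem_ofPred_eq, Set.mem_Iic, exists_prop] at hb ⊢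
    exact ⟨deg b, by omega, rfl⟩
  have := hfin.to_subtype
  have := finite_intComponent 𝒜 h𝒜
  let φ : freeGr 𝒜 deg j →ₗ[K] (b : {b | (deg b : ℤ) ≤ j}) → intComponent 𝒜 (j - deg b.1) :=
    { toFun := fun x b => ⟨x.1 b.1, x.2 b.1⟩
      map_add' := fun _ _ => rfl
      map_smul' := fun _ _ => rfl }
  refine Module.Finite.of_injective φ fun x y hxy => Subtype.ext (Finsupp.ext fun b => ?_)
  by_cases hb : (deg b : ℤ) ≤ j
  · exact congrArg Subtype.val (congrFun hxy ⟨b, hb⟩)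
  · have hx := x.2 b
    have hy := y.2 b
    rw [intComponent_of_neg 𝒜 (by omega), Submodule.mem_bot] at hx hy
    rw [hx, hy]

/-- In a free module of finite rank, a homogeneous component is the product of components of `A`. -/
noncomputable def freeGrEquiv [Finite ι] (j : ℤ) :
    freeGr 𝒜 deg j ≃ₗ[K] ((b : ι) → intComponent 𝒜 (j - deg b)) where
  toFun x b := ⟨x.1 b, x.2 b⟩
  map_add' _ _ := rfl
  map_smul' _ _ := rfl
  invFun y := ⟨Finsupp.equivFunOnFinite.symm fun b => (y b).1, fun b => (y b).2⟩
  left_inv x := by ext; rfl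
  right_inv y := rfl

/-- The Hilbert function of `A`, extended by zero to the negative integers. -/
noncomputable def hilbertFun (j : ℤ) : ℕ := Module.finrank K (intComponent 𝒜 j)

theorem hilbertFun_of_neg {j : ℤ} (hj : j < 0) : hilbertFun 𝒜 j = 0 := by
  rw [hilbertFun, intComponent_of_neg 𝒜 hj, finrank_bot]

theorem finrank_freeGr (h𝒜 : IsLocallyFinite 𝒜) [Fintype ι] (j : ℤ) :
    Module.finrank K (freeGr 𝒜 deg j) = ∑ b, hilbertFun 𝒜 (j - deg b) := by
  have := finite_intComponent 𝒜 h𝒜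
  rw [(freeGrEquiv 𝒜 j).finrank_eq, Module.finrank_pi_fintype]
  rfl

end FreeGraded

/-! ### Construction of minimal graded free covers. -/

section MinimalResolution

variable {K : Type v} {A : Type u} [Field K] [Ring A] [Algebra K A]
variable (𝒜 : ℕ → Submodule K A) [GradedAlgebra 𝒜]

/-- A homogeneous submodule of a locally finite graded free module is spanned by its homogeneous
elements. -/
theorem le_of_homogeneous {ι : Type*} {deg : ι → ℕ} {Z N : Submodule A (ι →₀ A)}
    (hZ : ∀ x ∈ Z, ∀ j, freeProj 𝒜 deg j x ∈ Z)
    (h : ∀ n : ℕ, ∀ x ∈ Z, x ∈ freeGr 𝒜 deg n → x ∈ N) : Z ≤ N := by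
  intro x hx
  obtain ⟨s, hs⟩ := exists_sum_freeProj 𝒜 deg x
  rw [← hs]
  refine sum_mem fun j _ => ?_
  have hj := freeProj_mem 𝒜 j x (deg := deg)
  rcases lt_or_ge j 0 with hj0 | hj0
  · rw [freeGr_of_neg 𝒜 hj0, Submodule.mem_bot] at hj
    rw [hj]
    exact zero_mem _
  · lift j to ℕ using hj0
    exact h j _ (hZ x hx j) hj

/-- A homogeneous submodule of a graded free module has a minimal cover by a graded free module. -/
theorem exists_minimal_cover (hc : IsConnectedGraded 𝒜) (hf : IsLocallyFinite 𝒜) {ι : Type u}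
    {deg : ι → ℕ} (hdeg : ∀ n, {b | deg b = n}.Finite) (Z : Submodule A (ι →₀ A))
    (hZ : ∀ x ∈ Z, ∀ j, freeProj 𝒜 deg j x ∈ Z) :
    ∃ (κ : Type u) (deg' : κ → ℕ) (D : (κ →₀ A) →ₗ[A] (ι →₀ A)),
      (∀ n, {b | deg' b = n}.Finite) ∧
      (∀ b, D (Finsupp.single b 1) ∈ freeGr 𝒜 deg (deg' b)) ∧
      LinearMap.range D = Z ∧
      ∀ x, D x = 0 → ∀ b, x ∈ freeGr 𝒜 deg' (deg' b) → x b = 0 := by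
  classical
  -- `C n` is a complement, inside the degree-`n` part `Zn n` of `Z`, of what the parts of lower
  -- degree already generate. Bases of the `C n` are the new generators.
  let Zn : ℕ → Submodule K (ι →₀ A) := fun n => Z.restrictScalars K ⊓ freeGr 𝒜 deg n
  let L : ℕ → Submodule A (ι →₀ A) := fun n =>
    Submodule.span A {x | ∃ m, m < n ∧ x ∈ Zn m}
  let W : ℕ → Submodule K (ι →₀ A) := fun n => Zn n ⊓ (L n).restrictScalars K
  choose C' hC' using fun n => (W n).exists_isCompl
  let C : ℕ → Submodule K (ι →₀ A) := fun n => Zn n ⊓ C' n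
  have hCfin : ∀ n, Module.Finite K (C n) := fun n => by
    have := finite_freeGr 𝒜 hf hdeg (n : ℤ)
    exact Submodule.finiteDimensional_of_le
      ((inf_le_left.trans inf_le_right : C n ≤ freeGr 𝒜 deg n))
  have hsup : ∀ n, Zn n ≤ W n ⊔ C n := fun n => by
    have h : (W n ⊔ C' n) ⊓ Zn n = W n ⊔ C' n ⊓ Zn n :=
      sup_inf_assoc_of_le _ inf_le_left
    rw [(hC' n).sup_eq_top, top_inf_eq, inf_comm] at h
    exact h.le
  have hdisj : ∀ n x, x ∈ W n → x ∈ C n → x = 0 := fun n x hW hC =>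
    (Submodule.disjoint_def.1 (hC' n).disjoint) x hW hC.2
  have hbasis : ∀ n, ∃ (J : Type u) (_ : Module.Basis J K (C n)), True := fun n =>
    ⟨_, Module.Basis.ofVectorSpace K (C n), trivial⟩
  choose J B _ using hbasis
  have hJ : ∀ n, Finite (J n) := fun n => Module.Finite.finite_basis (B n)
  let g : (Σ n, J n) → (ι →₀ A) := fun b => (B b.1 b.2 : C b.1)
  have hgC : ∀ b, g b ∈ C b.1 := fun b => (B b.1 b.2).2
  have hgZ : ∀ b, g b ∈ Zn b.1 := fun b => (hgC b).1
  have hD : ∀ x, Finsupp.linearCombination A g x = x.sum fun b a => a • g b := fun x =>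
    Finsupp.linearCombination_apply A x
  have hrange : LinearMap.range (Finsupp.linearCombination A g) = Submodule.span A (Set.range g) :=
    Finsupp.range_linearCombination A
  refine ⟨Σ n, J n, Sigma.fst, Finsupp.linearCombination A g, fun n => ?_, fun b => ?_, ?_, ?_⟩
  · refine (Set.finite_range (Sigma.mk n : J n → _)).subset ?_
    rintro ⟨m, b⟩ rfl
    exact ⟨b, rfl⟩
  · rw [Finsupp.linearCombination_single, one_smul]
    exact (hgZ b).2
  · rw [hrange]
    apply le_antisymm
    · rw [Submodule.span_le]
      rintro _ ⟨b, rfl⟩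
      exact (hgZ b).1
    · have key : ∀ n, Zn n ≤ (Submodule.span A (Set.range g)).restrictScalars K := by
        intro n
        induction n using Nat.strong_induction_on with
        | _ n ih =>
          refine (hsup n).trans (sup_le ?_ ?_)
          · refine inf_le_right.trans fun x hx => ?_
            have : L n ≤ Submodule.span A (Set.range g) := by
              rw [Submodule.span_le]
              rintro x ⟨m, hm, hx⟩
              exact ih m hm hx
            exact this hx
          · intro x hx
            have htop : (⊤ : Submodule K (C n)) ≤
                ((Submodule.span A (Set.range g)).restrictScalars K).comap (C n).subtype := by
              rw [← (B n).span_eq, Submodule.span_le]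
              rintro _ ⟨t, rfl⟩
              exact Submodule.subset_span ⟨⟨n, t⟩, rfl⟩
            exact htop (x := ⟨x, hx⟩) trivial
      exact le_of_homogeneous 𝒜 hZ fun n x hx hxn => key n ⟨hx, hxn⟩
  · rintro x hx ⟨n, s⟩ hxn
    -- In a relation of degree `n`, generators of degree below `n` contribute to `L n`, and those of
    -- degree above `n` have coefficients of negative degree, hence zero.
    have hterm : ∀ m, m ≠ n → (Finsupp.split x m).sum (fun t a => a • g ⟨m, t⟩) ∈ L n := by
      intro m hm
      refine sum_mem fun t _ => ?_
      rcases lt_or_gt_of_ne hm with h | h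
      · exact Submodule.smul_mem _ _ (Submodule.subset_span ⟨m, h, hgZ ⟨m, t⟩⟩)
      · have h0 := hxn ⟨m, t⟩
        rw [intComponent_of_neg 𝒜 (by simpa using h), Submodule.mem_bot] at h0
        have h1 : Finsupp.split x m t • g ⟨m, t⟩ = 0 := by
          rw [Finsupp.split_apply, h0, zero_smul]
        change Finsupp.split x m t • g ⟨m, t⟩ ∈ L n
        rw [h1]
        exact zero_mem _
    -- The coefficients of the generators of degree `n` lie in `A₀ = K`. Their combination is in `C
    -- n` and, by the relation, in `L n`, so it vanishes, and the basis of `C n` makes each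
    -- coefficient zero.
    have hscalar : ∀ t : J n, ∃ k : K, algebraMap K A k = x ⟨n, t⟩ := by
      intro t
      have h0 := hxn ⟨n, t⟩
      rw [sub_self, ← Nat.cast_zero, intComponent_natCast, hc.zero_eq_one] at h0
      exact Submodule.mem_one.1 h0
    choose k hk using hscalar
    have hsmul : ∀ (t : J n), x ⟨n, t⟩ • g ⟨n, t⟩ = k t • g ⟨n, t⟩ := fun t => by
      rw [← hk, algebraMap_smul]
    have heq : (Finsupp.split x n).sum (fun t a => a • g ⟨n, t⟩) =
        ∑ t ∈ (Finsupp.split x n).support, k t • g ⟨n, t⟩ :=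
      Finset.sum_congr rfl fun t _ => (by rw [Finsupp.split_apply, hsmul] :
        Finsupp.split x n t • g ⟨n, t⟩ = k t • g ⟨n, t⟩)
    have hCn : ∑ t ∈ (Finsupp.split x n).support, k t • g ⟨n, t⟩ ∈ C n :=
      sum_mem fun t _ => Submodule.smul_mem _ _ (hgC ⟨n, t⟩)
    have hLn : ∑ t ∈ (Finsupp.split x n).support, k t • g ⟨n, t⟩ ∈ L n := by
      rw [hD, Finsupp.sigma_sum] at hx
      by_cases hn : n ∈ Finsupp.splitSupport x
      · rw [← Finset.add_sum_erase _ _ hn, heq] at hx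
        rw [eq_neg_of_add_eq_zero_left hx]
        exact neg_mem (sum_mem fun m hm => hterm m (Finset.ne_of_mem_erase hm))
      · rw [Finsupp.mem_splitSupport_iff_nonzero, not_not] at hn
        rw [hn]
        simp
    have h0 := hdisj n _ ⟨hCn.1, hLn⟩ hCn
    have hli : LinearIndependent K fun t : J n => g ⟨n, t⟩ :=
      LinearMap.linearIndependent_iff_of_injOn (v := B n) (C n).subtype
        (Subtype.val_injective.injOn) |>.2 (B n).linearIndependent
    by_contra hne
    have hks := linearIndependent_iff'.1 hli _ _ h0 s (by
      rw [Finsupp.mem_support_iff, Finsupp.split_apply]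
      exact hne)
    apply hne
    rw [← hk, hks, map_zero]

/-- A stage of the minimal resolution: a graded free module with a homogeneous submodule `Z` (the
next syzygy) contained in the submodule generated by the elements of positive degree of `A`. -/
structure ResolutionStage where
  ι : Type u
  deg : ι → ℕ
  finite_deg : ∀ n, {b | deg b = n}.Finite
  Z : Submodule A (ι →₀ A)
  homogeneous : ∀ x ∈ Z, ∀ j, freeProj 𝒜 deg j x ∈ Z
  minimal : ∀ x ∈ Z, ∀ b, x ∈ freeGr 𝒜 deg (deg b) → x b = 0

namespace ResolutionStage

variable {𝒜}

theorem exists_next (hc : IsConnectedGraded 𝒜) (hf : IsLocallyFinite 𝒜) (S : ResolutionStage 𝒜) :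
    ∃ (T : ResolutionStage 𝒜) (D : (T.ι →₀ A) →ₗ[A] (S.ι →₀ A)),
      (∀ b, D (Finsupp.single b 1) ∈ freeGr 𝒜 S.deg (T.deg b)) ∧
      LinearMap.range D = S.Z ∧ LinearMap.ker D = T.Z := by
  obtain ⟨κ, deg', D, h1, h2, h3, h4⟩ := exists_minimal_cover 𝒜 hc hf S.finite_deg S.Z S.homogeneous
  refine ⟨⟨κ, deg', h1, LinearMap.ker D, fun x hx j => ?_, h4⟩, D, h2, h3, rfl⟩
  rw [LinearMap.mem_ker, map_freeProj 𝒜 D h2, LinearMap.mem_ker.1 hx, map_zero]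

variable (𝒜) in
/-- The first stage: the free module `A` and the ideal of elements of positive degree. -/
noncomputable def init : ResolutionStage 𝒜 where
  ι := PUnit
  deg _ := 0
  finite_deg _ := Set.toFinite _
  Z := Submodule.comap
    (Finsupp.lapply PUnit.unit : (PUnit.{u + 1} →₀ A) →ₗ[A] A)
    (HomogeneousIdeal.irrelevant 𝒜).toIdeal
  homogeneous x hx j := by
    change GradedAlgebra.proj 𝒜 0 (x PUnit.unit) = 0 at hx
    change GradedAlgebra.proj 𝒜 0 (intProj 𝒜 (j - (0 : ℕ)) (x PUnit.unit)) = 0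
    rw [Nat.cast_zero, sub_zero]
    by_cases hj : j = 0
    · subst hj
      have : intProj 𝒜 0 (x PUnit.unit) = 0 := hx
      rw [this, map_zero]
    · exact intProj_of_mem_ne 𝒜 hj (intProj_mem 𝒜 j (x PUnit.unit))
  minimal x hx b hb := by
    change GradedAlgebra.proj 𝒜 0 (x b) = 0 at hx
    have h := intProj_of_mem 𝒜 (hb b)
    rw [sub_self] at h
    rw [← h]
    exact hx

end ResolutionStage

end MinimalResolution

/-! ### The minimal resolution of the trivial module and its length. -/

section Termination

open CategoryTheory

theorem hasProjectiveDimensionLT_ker {A : Type u} [Ring A] {F M : Type u} [AddCommGroup F]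
    [Module A F] [AddCommGroup M] [Module A M] [Module.Projective A F] (f : F →ₗ[A] M)
    (hf : Function.Surjective f) (n : ℕ)
    (hM : HasProjectiveDimensionLT (ModuleCat.of A M) (n + 2)) :
    HasProjectiveDimensionLT (ModuleCat.of A (LinearMap.ker f)) (n + 1) := by
  let S : ShortComplex (ModuleCat.{u} A) :=
    ShortComplex.mk (ModuleCat.ofHom (LinearMap.ker f).subtype) (ModuleCat.ofHom f)
      (by ext x; exact x.2)
  have hS : S.ShortExact :=
    { exact := (ShortComplex.ShortExact.moduleCat_exact_iff_function_exact S).2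
        (LinearMap.exact_subtype_ker_map f)
      mono_f := (ModuleCat.mono_iff_injective _).2 Subtype.val_injective
      epi_g := (ModuleCat.epi_iff_surjective _).2 hf }
  have hF : Projective S.X₂ := (IsProjective.iff_projective F).1 inferInstance
  exact (hS.hasProjectiveDimensionLT_X₃_iff n hF).1 hM

variable {K : Type v} {A : Type u} [Field K] [Ring A] [Algebra K A]
variable {𝒜 : ℕ → Submodule K A} [GradedAlgebra 𝒜]

namespace ResolutionStage

/-- A minimal cover of a projective module has trivial kernel. -/
theorem Z_eq_bot_of_projective (S : ResolutionStage 𝒜) {M : Type*} [AddCommGroup M] [Module A M]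
    [Module.Projective A M] (f : (S.ι →₀ A) →ₗ[A] M) (hf : Function.Surjective f)
    (hker : LinearMap.ker f = S.Z) : S.Z = ⊥ := by
  obtain ⟨s, hs⟩ := Module.projective_lifting_property f LinearMap.id hf
  have hs' : ∀ y, f (s y) = y := fun y => LinearMap.congr_fun hs y
  -- Splitting the cover gives a projection `ρ` of the free module onto `Z`. It need not preserve
  -- degrees, so homogeneous components are taken below.
  let ρ : (S.ι →₀ A) →ₗ[A] (S.ι →₀ A) := LinearMap.id - s ∘ₗ f
  have hρZ : ∀ x, ρ x ∈ S.Z := fun x => by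
    rw [← hker, LinearMap.mem_ker]
    simp [ρ, hs']
  have hρ : ∀ x ∈ S.Z, ρ x = x := fun x hx => by
    rw [← hker, LinearMap.mem_ker] at hx
    simp [ρ, hx]
  rw [eq_bot_iff]
  refine le_of_homogeneous 𝒜 S.homogeneous fun n => ?_
  induction n using Nat.strong_induction_on with
  | _ n ih =>
    intro x hx hxn
    have hsum : x = x.sum fun b a => a • ρ (Finsupp.single b 1) := by
      conv_lhs => rw [← hρ x hx, ρ.apply_eq_finsuppSum]
    rw [Submodule.mem_bot, ← freeProj_of_mem 𝒜 hxn]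
    conv_lhs => rw [hsum]
    rw [Finsupp.sum, map_sum]
    refine Finset.sum_eq_zero fun b hb => ?_
    rw [Finsupp.mem_support_iff] at hb
    -- Minimality removes the coordinates with `deg b = n`. For the remaining ones, the degree-`n`
    -- component of `x b • ρ(e_b)` is `x b` times the component of `ρ(e_b)` in degree `deg b < n`,
    -- which lies in `Z` and is zero by induction.
    have hlt : S.deg b < n := by
      rcases lt_trichotomy (S.deg b) n with h | h | h
      · exact h
      · exact absurd (S.minimal x hx b (by rwa [h])) hb
      · refine absurd ?_ hb
        have h0 := hxn b
        rw [intComponent_of_neg 𝒜 (by omega)] at h0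
        exact h0
    have h1 := freeProj_smul 𝒜 (hxn b) (S.deg b) (ρ (Finsupp.single b 1)) (deg := S.deg)
    rw [sub_add_cancel] at h1
    rw [h1, (Submodule.mem_bot A).1 (ih _ hlt _ (S.homogeneous _ (hρZ _) _) (freeProj_mem 𝒜 _ _)),
      smul_zero]

variable (hc : IsConnectedGraded 𝒜) (hf : IsLocallyFinite 𝒜)

/-- The stages of the minimal resolution of the trivial module. -/
noncomputable def stage : ℕ → ResolutionStage 𝒜
  | 0 => init 𝒜
  | i + 1 => (exists_next hc hf (stage i)).choose

/-- The differentials of the minimal resolution of the trivial module. -/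
noncomputable def diff (i : ℕ) :
    ((stage hc hf (i + 1)).ι →₀ A) →ₗ[A] ((stage hc hf i).ι →₀ A) :=
  (exists_next hc hf (stage hc hf i)).choose_spec.choose

theorem diff_basis_mem (i : ℕ) (b : (stage hc hf (i + 1)).ι) :
    diff hc hf i (Finsupp.single b 1) ∈
      freeGr 𝒜 (stage hc hf i).deg ((stage hc hf (i + 1)).deg b) :=
  (exists_next hc hf (stage hc hf i)).choose_spec.choose_spec.1 b

theorem range_diff (i : ℕ) : LinearMap.range (diff hc hf i) = (stage hc hf i).Z :=
  (exists_next hc hf (stage hc hf i)).choose_spec.choose_spec.2.1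

theorem ker_diff (i : ℕ) : LinearMap.ker (diff hc hf i) = (stage hc hf (i + 1)).Z :=
  (exists_next hc hf (stage hc hf i)).choose_spec.choose_spec.2.2

/-- The augmentation onto the trivial module. -/
noncomputable def augmentation : ((stage hc hf 0).ι →₀ A) →ₗ[A] TrivialModule 𝒜 :=
  Submodule.mkQ (HomogeneousIdeal.irrelevant 𝒜).toIdeal ∘ₗ
    (Finsupp.lapply PUnit.unit : (PUnit.{u + 1} →₀ A) →ₗ[A] A)

theorem augmentation_surjective : Function.Surjective (augmentation hc hf) := by
  intro y
  obtain ⟨a, rfl⟩ := Submodule.mkQ_surjective _ y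
  exact ⟨(Finsupp.single PUnit.unit a : PUnit.{u + 1} →₀ A),
    congrArg _ (Finsupp.single_eq_same (a := PUnit.unit.{u + 1}))⟩

theorem ker_augmentation : LinearMap.ker (augmentation hc hf) = (stage hc hf 0).Z := by
  ext x
  exact Submodule.Quotient.mk_eq_zero _

/-- The minimal graded free resolution of the trivial module. -/
noncomputable def resolution : GradedProjectiveResolution 𝒜 where
  P i := (stage hc hf i).ι →₀ A
  projective i := inferInstance
  gr i j := (freeGr 𝒜 (stage hc hf i).deg j).toAddSubgroup
  isInternal i := isInternal_freeGr 𝒜 (stage hc hf i).deg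
  smul_mem i m j a x ha hx := smul_mem_freeGr 𝒜 (i := (m : ℤ)) ha hx
  d i := diff hc hf i
  d_mem i j x hx := map_mem_freeGr 𝒜 (diff hc hf i) (diff_basis_mem hc hf i) hx
  ε := augmentation hc hf
  ε_eq_zero j x hj hx := by
    rw [← LinearMap.mem_ker, ker_augmentation]
    have h : x PUnit.unit ∈ intComponent 𝒜 (j - (0 : ℕ)) := hx PUnit.unit
    rw [Nat.cast_zero, sub_zero] at h
    exact intProj_of_mem_ne 𝒜 hj h
  exact_d i := LinearMap.exact_iff.2 (by rw [ker_diff, range_diff])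
  exact_ε := LinearMap.exact_iff.2 (by rw [ker_augmentation, range_diff])
  surjective_ε := augmentation_surjective hc hf

/-- The differential of the minimal resolution, with values in the syzygy. -/
noncomputable def diffToZ (i : ℕ) :
    ((stage hc hf (i + 1)).ι →₀ A) →ₗ[A] (stage hc hf i).Z :=
  (diff hc hf i).codRestrict _ fun x => by
    rw [← range_diff]
    exact LinearMap.mem_range_self _ x

theorem ker_diffToZ (i : ℕ) : LinearMap.ker (diffToZ hc hf i) = (stage hc hf (i + 1)).Z := by
  rw [diffToZ, LinearMap.ker_codRestrict, ker_diff]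

theorem diffToZ_surjective (i : ℕ) : Function.Surjective (diffToZ hc hf i) := by
  rintro ⟨y, hy⟩
  rw [← range_diff] at hy
  obtain ⟨x, rfl⟩ := hy
  exact ⟨x, rfl⟩

/-- Dimension shifting: each syzygy lowers the bound by one. -/
theorem hasProjectiveDimensionLT_Z (i n : ℕ)
    (h : HasProjectiveDimensionLT (ModuleCat.of A (TrivialModule 𝒜)) (n + i + 2)) :
    HasProjectiveDimensionLT (ModuleCat.of A (stage hc hf i).Z) (n + 1) := by
  induction i generalizing n with
  | zero =>
    have := hasProjectiveDimensionLT_ker _ (augmentation_surjective hc hf) n h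
    rwa [ker_augmentation] at this
  | succ i ih =>
    have := hasProjectiveDimensionLT_ker _ (diffToZ_surjective hc hf i) n
      (ih (n + 1) (by rwa [show n + 1 + i + 2 = n + (i + 1) + 2 by omega]))
    rwa [ker_diffToZ] at this

/-- The free module of stage `d` minimally covers a module that dimension shifting makes projective:
the trivial module if `d = 0`, the syzygy of stage `d - 1` otherwise. -/
theorem Z_eq_bot {d : ℕ} (hd : globalDimension A ≤ d) : (stage hc hf d).Z = ⊥ := by
  have hK : HasProjectiveDimensionLT (ModuleCat.of A (TrivialModule 𝒜)) (d + 1) :=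
    (projectiveDimension_le_iff _ _).1 ((le_iSup _ _).trans hd)
  cases d with
  | zero =>
    have : Module.Projective A (TrivialModule 𝒜) :=
      (IsProjective.iff_projective _).2 (projective_iff_hasProjectiveDimensionLT_one.2 hK)
    exact Z_eq_bot_of_projective _ _ (augmentation_surjective hc hf) (ker_augmentation hc hf)
  | succ i =>
    have : Module.Projective A (stage hc hf i).Z :=
      (IsProjective.iff_projective _).2 (projective_iff_hasProjectiveDimensionLT_one.2
        (hasProjectiveDimensionLT_Z hc hf i 0 (by rwa [zero_add])))
    refine Z_eq_bot_of_projective (M := (stage hc hf i).Z) (stage hc hf (i + 1)) (diffToZ hc hf i)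
      (diffToZ_surjective hc hf i) ?_
    exact ker_diffToZ hc hf i

/-- A basis vector killed by the differential lies in the next syzygy, where minimality would force
its own coordinate `1` to vanish. -/
theorem isEmpty_of_Z_eq_bot {i : ℕ} (h : (stage hc hf i).Z = ⊥) :
    IsEmpty (stage hc hf (i + 1)).ι := by
  refine ⟨fun b => ?_⟩
  have := hc.nontrivial
  have h1 : diff hc hf i (Finsupp.single b 1) ∈ (stage hc hf i).Z := by
    rw [← range_diff]
    exact LinearMap.mem_range_self _ _
  rw [h, Submodule.mem_bot, ← LinearMap.mem_ker, ker_diff] at h1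
  have h2 := (stage hc hf (i + 1)).minimal _ h1 b (basis_mem_freeGr 𝒜 b)
  rw [Finsupp.single_eq_same] at h2
  exact one_ne_zero h2

theorem diff_minimal (i : ℕ) (b : (stage hc hf (i + 1)).ι) (c : (stage hc hf i).ι)
    (hbc : (stage hc hf i).deg c = (stage hc hf (i + 1)).deg b) :
    diff hc hf i (Finsupp.single b 1) c = 0 := by
  refine (stage hc hf i).minimal _ ?_ c ?_
  · rw [← range_diff]
    exact LinearMap.mem_range_self _ _
  · rw [hbc]
    exact diff_basis_mem hc hf i b

end ResolutionStage

end Termination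

/-! ### Euler characteristics of the resolution and its dual; bounds from the Gorenstein condition.
-/

section EulerCharacteristic

theorem finrank_map_add_finrank_inf_ker {K V W : Type*} [Field K] [AddCommGroup V] [Module K V]
    [AddCommGroup W] [Module K W] (H : Submodule K V) [Module.Finite K H] (φ : V →ₗ[K] W) :
    Module.finrank K (H.map φ) + Module.finrank K (H ⊓ LinearMap.ker φ : Submodule K V) =
      Module.finrank K H := by
  have h := LinearMap.finrank_range_add_finrank_ker (φ.domRestrict H)
  rwa [LinearMap.range_domRestrict, LinearMap.ker_domRestrict, ← Submodule.finrank_map_subtype_eq,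
    Submodule.map_comap_subtype] at h

/-- Here `c`, `z`, `b`, `e` stand for the dimensions of cochains, cocycles, coboundaries and
cohomology. The extra term in `b n` is what truncation at `n` leaves over. -/
theorem alternating_sum_eq {c z b e : ℕ → ℕ} (h1 : ∀ i, b (i + 1) + z i = c i)
    (h2 : ∀ i, e i + b i = z i) (h0 : b 0 = 0) (n : ℕ) :
    ∑ i ∈ Finset.range n, (-1 : ℤ) ^ i * c i + (-1) ^ n * b n =
      ∑ i ∈ Finset.range n, (-1 : ℤ) ^ i * e i := by
  induction n with
  | zero => simp [h0]
  | succ n ih =>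
    rw [Finset.sum_range_succ, Finset.sum_range_succ, ← ih, ← h1, ← h2]
    push_cast
    ring

variable {K : Type v} {A : Type u} [Field K] [Ring A] [Algebra K A]
variable {𝒜 : ℕ → Submodule K A} [GradedAlgebra 𝒜]

namespace GradedProjectiveResolution

variable (R : GradedProjectiveResolution 𝒜)

theorem finrank_coboundaries_succ_add (i : ℕ) (n : ℤ) [Module.Finite K (R.homDegree i n)] :
    Module.finrank K (R.coboundaries (i + 1) n) + Module.finrank K (R.cocycles i n) =
      Module.finrank K (R.homDegree i n) :=
  finrank_map_add_finrank_inf_ker (R.homDegree i n) (R.precomp i)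

theorem finrank_extDegree_add (i : ℕ) (n : ℤ) [Module.Finite K (R.homDegree i n)] :
    Module.finrank K (R.extDegree i n) + Module.finrank K (R.coboundaries i n) =
      Module.finrank K (R.cocycles i n) := by
  have : Module.Finite K (R.cocycles i n) := Submodule.finiteDimensional_of_le inf_le_left
  have h := finrank_map_add_finrank_inf_ker (R.cocycles i n) (R.coboundaries i n).mkQ
  rwa [Submodule.ker_mkQ, inf_eq_right.2 (R.coboundaries_le_cocycles i n)] at h

theorem alternating_sum_homDegree (n : ℤ) [∀ i, Module.Finite K (R.homDegree i n)] {d : ℕ}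
    (hd : Subsingleton (R.P (d + 1))) :
    ∑ i ∈ Finset.range (d + 1), (-1 : ℤ) ^ i * Module.finrank K (R.homDegree i n) =
      ∑ i ∈ Finset.range (d + 1), (-1 : ℤ) ^ i * Module.finrank K (R.extDegree i n) := by
  rw [← alternating_sum_eq (fun i => R.finrank_coboundaries_succ_add i n)
    (fun i => R.finrank_extDegree_add i n) (finrank_bot K _)]
  have : Subsingleton (R.P (d + 1) →ₗ[A] A) :=
    ⟨fun f g => LinearMap.ext fun x => by rw [Subsingleton.elim x 0, map_zero, map_zero]⟩
  rw [Module.finrank_zero_of_subsingleton (M := R.coboundaries (d + 1) n)]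
  simp

theorem cocycles_le_coboundaries {i : ℕ} {n : ℤ} (h : Subsingleton (R.extDegree i n)) :
    R.cocycles i n ≤ R.coboundaries i n := by
  intro f hf
  have h0 : (⟨_, Submodule.mem_map_of_mem hf⟩ : R.extDegree i n) = 0 := Subsingleton.elim _ _
  exact (Submodule.Quotient.mk_eq_zero _).1 (congrArg Subtype.val h0)

end GradedProjectiveResolution

namespace ResolutionStage

variable (hc : IsConnectedGraded 𝒜) (hf : IsLocallyFinite 𝒜)

theorem apply_eq_zero {ι M : Type*} [AddCommGroup M] [Module A M] (f : (ι →₀ A) →ₗ[A] M)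
    (x : ι →₀ A) (h : ∀ b, x b • f (Finsupp.single b 1) = 0) : f x = 0 := by
  rw [LinearMap.apply_eq_finsuppSum f x]
  exact Finset.sum_eq_zero fun b _ => h b

theorem apply_mem_intComponent {ι : Type*} {deg : ι → ℕ} {n j : ℤ} (f : (ι →₀ A) →ₗ[A] A)
    (h : ∀ b, f (Finsupp.single b 1) ∈ intComponent 𝒜 (n + deg b)) {x : ι →₀ A}
    (hx : x ∈ freeGr 𝒜 deg j) : f x ∈ intComponent 𝒜 (n + j) := by
  rw [LinearMap.apply_eq_finsuppSum f x]
  refine sum_mem fun b _ => ?_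
  have := mul_mem_intComponent 𝒜 (hx b) (h b)
  rwa [show j - (deg b : ℤ) + (n + deg b) = n + j by ring] at this

theorem mem_homDegree_iff (i : ℕ) (n : ℤ) (f : ((stage hc hf i).ι →₀ A) →ₗ[A] A) :
    f ∈ (resolution hc hf).homDegree i n ↔
      ∀ b, f (Finsupp.single b 1) ∈ intComponent 𝒜 (n + (stage hc hf i).deg b) := by
  constructor
  · intro h b
    exact h _ _ (basis_mem_freeGr 𝒜 b)
  · intro h j x hx
    exact apply_mem_intComponent f h hx

/-- Homogeneous maps from a finite free module to `A` are given by the images of the basis. -/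
noncomputable def homDegreeEquiv (i : ℕ) (n : ℤ) :
    (resolution hc hf).homDegree i n ≃ₗ[K]
      ((b : (stage hc hf i).ι) → intComponent 𝒜 (n + (stage hc hf i).deg b)) where
  toFun f b := ⟨f.1 (Finsupp.single b 1), (mem_homDegree_iff hc hf i n f.1).1 f.2 b⟩
  map_add' _ _ := rfl
  map_smul' _ _ := rfl
  invFun y := ⟨Finsupp.linearCombination A fun b => (y b).1,
    (mem_homDegree_iff hc hf i n _).2 fun b => by
      rw [Finsupp.linearCombination_single, one_smul]
      exact (y b).2⟩
  left_inv f := by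
    refine Subtype.ext (LinearMap.ext fun x => ?_)
    exact (LinearMap.apply_eq_finsuppSum f.1 x).symm
  right_inv y := by
    funext b
    refine Subtype.ext ?_
    change Finsupp.linearCombination A (fun b => (y b).1) (Finsupp.single b 1) = _
    rw [Finsupp.linearCombination_single, one_smul]

theorem finite_homDegree (i : ℕ) [Finite (stage hc hf i).ι] (n : ℤ) :
    Module.Finite K ((resolution hc hf).homDegree i n) := by
  have := finite_intComponent 𝒜 hf
  exact Module.Finite.equiv (homDegreeEquiv hc hf i n).symm

theorem finrank_homDegree (i : ℕ) [Fintype (stage hc hf i).ι] (n : ℤ) :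
    Module.finrank K ((resolution hc hf).homDegree i n) =
      ∑ b, hilbertFun 𝒜 (n + (stage hc hf i).deg b) := by
  have := finite_intComponent 𝒜 hf
  rw [(homDegreeEquiv hc hf i n).finrank_eq, Module.finrank_pi_fintype]
  rfl

/-- The coordinate function of a basis vector of the `i`-th term of the minimal resolution. -/
noncomputable def coord (i : ℕ) (b : (stage hc hf i).ι) : (resolution hc hf).P i →ₗ[A] A :=
  (Finsupp.lapply b : ((stage hc hf i).ι →₀ A) →ₗ[A] A)

theorem coord_mem_homDegree (i : ℕ) (b : (stage hc hf i).ι) :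
    coord hc hf i b ∈ (resolution hc hf).homDegree i (-(stage hc hf i).deg b) := by
  intro j x hx
  rw [neg_add_eq_sub]
  exact hx b

/-- A coboundary takes at the basis vector `b` the value `∑ D(e_b)_c * g(e_c)`, whose factors have
opposite degrees `deg b - deg c` and `deg c - deg b`. Unless both are zero, one factor vanishes; if
both are zero, minimality kills the first. So the value cannot be `1`. -/
theorem coord_notMem_coboundaries (i : ℕ) (b : (stage hc hf i).ι) :
    coord hc hf i b ∉ (resolution hc hf).coboundaries i (-(stage hc hf i).deg b) := by
  have := hc.nontrivial
  have h1 : coord hc hf i b (Finsupp.single b (1 : A) : (stage hc hf i).ι →₀ A) = 1 :=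
    Finsupp.single_eq_same
  intro hmem
  cases i with
  | zero =>
    have h0 : coord hc hf 0 b = 0 := hmem
    rw [h0] at h1
    exact zero_ne_one h1
  | succ i =>
    obtain ⟨g, hg, hgb⟩ := hmem
    rw [← hgb] at h1
    have hg' := (mem_homDegree_iff hc hf i _ g).1 hg
    have h2 : g (diff hc hf i (Finsupp.single b 1)) = 1 := h1
    refine zero_ne_one (α := A) ?_
    rw [← h2]
    refine (apply_eq_zero _ _ fun c => ?_).symm
    change diff hc hf i (Finsupp.single b 1) c • g (Finsupp.single c 1) = 0
    rcases lt_trichotomy ((stage hc hf i).deg c) ((stage hc hf (i + 1)).deg b) with h | h | h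
    · have h3 := hg' c
      rw [intComponent_of_neg 𝒜 (by omega), Submodule.mem_bot] at h3
      exact (congrArg _ h3).trans (smul_zero _)
    · rw [diff_minimal hc hf i b c h, zero_smul]
    · have h3 := diff_basis_mem hc hf i b c
      rw [intComponent_of_neg 𝒜 (by omega), Submodule.mem_bot] at h3
      rw [h3, zero_smul]

theorem coord_mem_cocycles (i : ℕ) (b : (stage hc hf i).ι)
    (h : ∀ c, (stage hc hf (i + 1)).deg c < (stage hc hf i).deg b) :
    coord hc hf i b ∈ (resolution hc hf).cocycles i (-(stage hc hf i).deg b) := by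
  refine ⟨coord_mem_homDegree hc hf i b, LinearMap.mem_ker.2 (LinearMap.ext fun x => ?_)⟩
  refine apply_eq_zero ((Finsupp.lapply b : ((stage hc hf i).ι →₀ A) →ₗ[A] A) ∘ₗ diff hc hf i) x
    fun c => ?_
  have h3 := diff_basis_mem hc hf i c b
  rw [intComponent_of_neg 𝒜 (by have := h c; omega), Submodule.mem_bot] at h3
  exact (congrArg _ h3).trans (smul_zero _)

/-- A generator of degree above all generators of the next term produces a nonzero Ext class: its
coordinate function is a cocycle because the differential would need entries of negative degree to
reach it. -/
theorem not_subsingleton_extDegree (i : ℕ) (b : (stage hc hf i).ι)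
    (h : ∀ c, (stage hc hf (i + 1)).deg c < (stage hc hf i).deg b) :
    ¬ Subsingleton ((resolution hc hf).extDegree i (-(stage hc hf i).deg b)) := fun hs =>
  coord_notMem_coboundaries hc hf i b
    ((resolution hc hf).cocycles_le_coboundaries hs (coord_mem_cocycles hc hf i b h))

theorem isEmpty_succ {d : ℕ} (hd : globalDimension A ≤ d) (k : ℕ) :
    IsEmpty (stage hc hf (d + k + 1)).ι := by
  apply isEmpty_of_Z_eq_bot
  induction k with
  | zero => exact Z_eq_bot hc hf hd
  | succ k ih =>
    have := isEmpty_of_Z_eq_bot hc hf ih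
    exact Subsingleton.elim _ _

/-- Under the Gorenstein condition the generators of the minimal resolution live in degrees at most
the index. -/
theorem deg_le {d : ℕ} (hd : globalDimension A ≤ d) {l : ℤ} (hl : IsGorensteinWithIndex 𝒜 d l)
    (k i : ℕ) (hi : i + k = d) (b : (stage hc hf i).ι) : (stage hc hf i).deg b ≤ l := by
  -- Downward induction on `i`, starting at `i = d`, where the next term is zero. A generator of
  -- degree above `l` would exceed all those of the next term and give a nonzero Ext group in a
  -- degree other than `-l`.
  induction k generalizing i with
  | zero =>
    obtain rfl : i = d := by omega
    have := isEmpty_succ hc hf hd 0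
    by_contra hb
    exact not_subsingleton_extDegree hc hf i b (fun c => isEmptyElim c)
      ((hl (resolution hc hf)).1 _ _ (by omega))
  | succ k ih =>
    by_contra hb
    refine not_subsingleton_extDegree hc hf i b (fun c => ?_)
      ((hl (resolution hc hf)).1 _ _ (by omega))
    have := ih (i + 1) (by omega) c
    omega

theorem finite_stage {d : ℕ} (hd : globalDimension A ≤ d) {l : ℤ}
    (hl : IsGorensteinWithIndex 𝒜 d l) (i : ℕ) : Finite (stage hc hf i).ι := by
  rcases le_or_gt i d with hi | hi
  · have h : (Set.univ : Set (stage hc hf i).ι).Finite :=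
      ((Set.finite_Iic l.toNat).biUnion fun n _ => (stage hc hf i).finite_deg n).subset fun b _ => by
        have := deg_le hc hf hd hl (d - i) i (by omega) b
        simp only [Set.mem_iUnion, Set.mem_ofPred_eq, Set.mem_Iic, exists_prop]
        exact ⟨_, by omega, rfl⟩
    exact Set.finite_univ_iff.1 h
  · obtain ⟨k, rfl⟩ : ∃ k, i = d + k + 1 := ⟨i - d - 1, by omega⟩
    have := isEmpty_succ hc hf hd k
    infer_instance

theorem hilbertFun_zero (hc : IsConnectedGraded 𝒜) : hilbertFun 𝒜 0 = 1 := by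
  have := hc.nontrivial
  rw [hilbertFun, ← Nat.cast_zero, intComponent_natCast, hc.zero_eq_one, Submodule.one_eq_span,
    finrank_span_singleton one_ne_zero]

/-- Rank-nullity in degree `n` for `0 → Z (i + 1) → P (i + 1) → Z i → 0`; preimages can be taken
homogeneous by applying `freeProj`. -/
theorem finrank_freeGr_succ (i : ℕ) (n : ℤ) :
    Module.finrank K (((stage hc hf i).Z.restrictScalars K ⊓
        freeGr 𝒜 (stage hc hf i).deg n : Submodule K _)) +
      Module.finrank K (((stage hc hf (i + 1)).Z.restrictScalars K ⊓
        freeGr 𝒜 (stage hc hf (i + 1)).deg n : Submodule K _)) =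
      Module.finrank K (freeGr 𝒜 (stage hc hf (i + 1)).deg n) := by
  have := finite_freeGr 𝒜 hf (stage hc hf (i + 1)).finite_deg n
  rw [← finrank_map_add_finrank_inf_ker (freeGr 𝒜 (stage hc hf (i + 1)).deg n)
    ((diff hc hf i).restrictScalars K)]
  have h1 : (stage hc hf i).Z.restrictScalars K ⊓ freeGr 𝒜 (stage hc hf i).deg n =
      (freeGr 𝒜 (stage hc hf (i + 1)).deg n).map ((diff hc hf i).restrictScalars K) := by
    ext y
    constructor
    · rintro ⟨hy, hyn⟩
      have hy' : y ∈ LinearMap.range (diff hc hf i) := by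
        rw [range_diff]
        exact hy
      obtain ⟨x, rfl⟩ := hy'
      refine ⟨freeProj 𝒜 (stage hc hf (i + 1)).deg n x, freeProj_mem 𝒜 n x, ?_⟩
      exact (map_freeProj 𝒜 _ (diff_basis_mem hc hf i) n x).trans (freeProj_of_mem 𝒜 hyn)
    · rintro ⟨x, hx, rfl⟩
      refine ⟨?_, map_mem_freeGr 𝒜 _ (diff_basis_mem hc hf i) hx⟩
      have : diff hc hf i x ∈ (stage hc hf i).Z := by
        rw [← range_diff]
        exact LinearMap.mem_range_self _ x
      exact this
  have h2 : (stage hc hf (i + 1)).Z.restrictScalars K ⊓ freeGr 𝒜 (stage hc hf (i + 1)).deg n =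
      freeGr 𝒜 (stage hc hf (i + 1)).deg n ⊓
        LinearMap.ker ((diff hc hf i).restrictScalars K) := by
    rw [inf_comm, ← ker_diff]
    rfl
  rw [h1, h2]

theorem finrank_freeGr_zero (n : ℤ) :
    (if n = 0 then 1 else 0) +
      Module.finrank K (((stage hc hf 0).Z.restrictScalars K ⊓
        freeGr 𝒜 (stage hc hf 0).deg n : Submodule K _)) =
      Module.finrank K (freeGr 𝒜 (stage hc hf 0).deg n) := by
  split_ifs with hn
  · subst hn
    have h0 : (stage hc hf 0).Z.restrictScalars K ⊓ freeGr 𝒜 (stage hc hf 0).deg 0 = ⊥ := by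
      rw [eq_bot_iff]
      rintro x ⟨hx, hxn⟩
      exact Finsupp.ext fun b => (stage hc hf 0).minimal x hx b hxn
    have : Fintype (stage hc hf 0).ι := inferInstanceAs (Fintype PUnit)
    rw [h0, finrank_bot, finrank_freeGr 𝒜 hf]
    have h1 : ∀ b : (stage hc hf 0).ι, hilbertFun 𝒜 (0 - (stage hc hf 0).deg b) = 1 := fun b =>
      hilbertFun_zero hc
    have h2 : Fintype.card (stage hc hf 0).ι = 1 :=
      Fintype.card_eq_one_iff.2 ⟨PUnit.unit, fun _ => rfl⟩
    rw [Finset.sum_congr rfl fun b _ => h1 b]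
    simp [h2]
  · rw [zero_add, inf_eq_right.2]
    intro x hx
    have h : x PUnit.unit ∈ intComponent 𝒜 (n - (0 : ℕ)) := hx PUnit.unit
    rw [Nat.cast_zero, sub_zero] at h
    exact intProj_of_mem_ne 𝒜 hn h

/-- The syzygy dimensions telescope, leaving the Hilbert function of the trivial module. These are
the coefficients of the identity `p * H = 1`. -/
theorem alternating_sum_freeGr {d : ℕ} (hd : globalDimension A ≤ d) (n : ℤ) :
    ∑ i ∈ Finset.range (d + 1), (-1 : ℤ) ^ i *
      Module.finrank K (freeGr 𝒜 (stage hc hf i).deg n) = if n = 0 then 1 else 0 := by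
  have key : ∀ k, ∑ i ∈ Finset.range (k + 1), (-1 : ℤ) ^ i *
      Module.finrank K (freeGr 𝒜 (stage hc hf i).deg n) = (if n = 0 then 1 else 0) + (-1) ^ k *
      Module.finrank K (((stage hc hf k).Z.restrictScalars K ⊓
        freeGr 𝒜 (stage hc hf k).deg n : Submodule K _)) := by
    intro k
    induction k with
    | zero =>
      rw [zero_add, Finset.sum_range_one, ← finrank_freeGr_zero]
      push_cast
      ring
    | succ k ih =>
      rw [Finset.sum_range_succ, ih, ← finrank_freeGr_succ]
      push_cast
      ring
  rw [key, Z_eq_bot hc hf hd]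
  have : (⊥ : Submodule A ((stage hc hf d).ι →₀ A)).restrictScalars K ⊓
      freeGr 𝒜 (stage hc hf d).deg n = ⊥ := by
    rw [Submodule.restrictScalars_bot, bot_inf_eq]
  rw [this, finrank_bot]
  simp

theorem alternating_sum_ext {d : ℕ} {l : ℤ} (hl : IsGorensteinWithIndex 𝒜 d l)
    (R : GradedProjectiveResolution 𝒜) (n : ℤ) :
    ∑ i ∈ Finset.range (d + 1), (-1 : ℤ) ^ i * Module.finrank K (R.extDegree i n) =
      if n = -l then (-1) ^ d else 0 := by
  rw [Finset.sum_eq_single_of_mem d (Finset.self_mem_range_succ d)]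
  · split_ifs with hn
    · subst hn
      obtain ⟨e⟩ := (hl R).2
      rw [e.finrank_eq, Module.finrank_self]
      simp
    · have := (hl R).1 d n (by simp [hn])
      rw [Module.finrank_zero_of_subsingleton]
      simp
  · intro i _ hi
    have := (hl R).1 i n (by simp [hi])
    rw [Module.finrank_zero_of_subsingleton]
    simp

end ResolutionStage

end EulerCharacteristic

/-! ### The functional equation of the Hilbert series. -/

section HilbertSeries

open Polynomial ResolutionStage

variable {K : Type v} {A : Type u} [Field K] [Ring A] [Algebra K A]

/-- The Hilbert series of a graded algebra. -/
noncomputable def hilbertSeries (𝒜 : ℕ → Submodule K A) : PowerSeries ℤ :=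
  PowerSeries.mk fun n => (Module.finrank K (𝒜 n) : ℤ)

variable {𝒜 : ℕ → Submodule K A} [GradedAlgebra 𝒜]

theorem coeff_X_pow_mul_hilbertSeries (e k : ℕ) :
    PowerSeries.coeff k ((PowerSeries.X : PowerSeries ℤ) ^ e * hilbertSeries 𝒜) =
      hilbertFun 𝒜 ((k : ℤ) - e) := by
  rw [PowerSeries.coeff_X_pow_mul']
  split_ifs with h
  · rw [hilbertSeries, PowerSeries.coeff_mk, ← Nat.cast_sub h, hilbertFun, intComponent_natCast]
  · rw [hilbertFun_of_neg 𝒜 (by omega), Nat.cast_zero]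

theorem reflect_finset_sum {R ι : Type*} [Semiring R] (N : ℕ) (s : Finset ι) (f : ι → R[X]) :
    (∑ i ∈ s, f i).reflect N = ∑ i ∈ s, (f i).reflect N :=
  map_sum (⟨⟨reflect N, reflect_zero⟩, fun f g => reflect_add f g N⟩ : R[X] →+ R[X]) f s

/-- The Hilbert series of an Artin-Schelter regular algebra is the inverse of a polynomial with a
functional equation. -/
theorem IsArtinSchelterRegular.exists_polynomial {d : ℕ} (hA : IsArtinSchelterRegular 𝒜 d) :
    ∃ (p : ℤ[X]) (M k : ℕ), p.natDegree ≤ M ∧ (p : PowerSeries ℤ) * hilbertSeries 𝒜 = 1 ∧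
      p.reflect M = (-1) ^ d * X ^ k * p := by
  classical
  have hc := hA.connected
  have hf := hA.locallyFinite
  have hd : globalDimension A ≤ d := hA.globalDimension_eq.le
  obtain ⟨l, hl⟩ := hA.gorenstein
  have hfin : ∀ i, Finite (stage hc hf i).ι :=
    finite_stage hc hf hd hl
  have : ∀ i, Fintype (stage hc hf i).ι := fun i => Fintype.ofFinite _
  have hdeg : ∀ i ∈ Finset.range (d + 1), ∀ b, (stage hc hf i).deg b ≤ l.toNat := fun i hi b => by
    have := deg_le hc hf hd hl (d - i) i (by simp at hi; omega) b
    omega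
  obtain ⟨M, hM⟩ : ∃ M, M = l.toNat := ⟨_, rfl⟩
  rw [← hM] at hdeg
  let p : ℤ[X] := ∑ i ∈ Finset.range (d + 1), C ((-1 : ℤ) ^ i) * ∑ b, X ^ (stage hc hf i).deg b
  let q : ℤ[X] := ∑ i ∈ Finset.range (d + 1), C ((-1 : ℤ) ^ i) * ∑ b, X ^ (M - (stage hc hf i).deg b)
  have hpM : p.natDegree ≤ M := by
    refine natDegree_sum_le_of_forall_le _ _ fun i hi => ?_
    refine (natDegree_C_mul_le _ _).trans (natDegree_sum_le_of_forall_le _ _ fun b _ => ?_)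
    rw [natDegree_X_pow]
    exact hdeg i hi b
  have hq : p.reflect M = q := by
    rw [reflect_finset_sum]
    refine Finset.sum_congr rfl fun i hi => ?_
    rw [reflect_C_mul, reflect_finset_sum]
    congr 1
    refine Finset.sum_congr rfl fun b _ => ?_
    rw [reflect_monomial, revAt_le (hdeg i hi b)]
  have coeffp : ∀ (e : (i : ℕ) → (stage hc hf i).ι → ℕ) (k : ℕ), PowerSeries.coeff k
      (((∑ i ∈ Finset.range (d + 1), C ((-1 : ℤ) ^ i) * ∑ b, X ^ e i b : ℤ[X]) : PowerSeries ℤ) *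
        hilbertSeries 𝒜) =
      ∑ i ∈ Finset.range (d + 1), (-1 : ℤ) ^ i *
        (∑ b, hilbertFun 𝒜 ((k : ℤ) - e i b) : ℕ) := by
    intro e k
    rw [← coeToPowerSeries.ringHom_apply, map_sum, Finset.sum_mul, map_sum]
    refine Finset.sum_congr rfl fun i _ => ?_
    rw [map_mul coeToPowerSeries.ringHom, mul_assoc, coeToPowerSeries.ringHom_apply, coe_C, PowerSeries.coeff_C_mul,
      map_sum, Finset.sum_mul, map_sum, Nat.cast_sum]
    congr 1
    refine Finset.sum_congr rfl fun b _ => ?_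
    rw [coeToPowerSeries.ringHom_apply, coe_pow, coe_X, coeff_X_pow_mul_hilbertSeries]
  have hp1 : (p : PowerSeries ℤ) * hilbertSeries 𝒜 = 1 := by
    ext k
    have h1 : (if k = 0 then (1 : ℤ) else 0) = if (k : ℤ) = 0 then 1 else 0 := by
      simp only [Nat.cast_eq_zero]
    rw [coeffp, PowerSeries.coeff_one, h1, ← alternating_sum_freeGr hc hf hd (k : ℤ)]
    refine Finset.sum_congr rfl fun i _ => ?_
    rw [finrank_freeGr 𝒜 hf]
  -- The coefficient in degree `k` is the Euler characteristic of `Hom(P, A)` in degree `k - M`, to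
  -- which Ext contributes only when `k = M - l`. As `M = l.toNat ≥ l`, the truncation in `toNat`
  -- loses nothing.
  have hq1 : (q : PowerSeries ℤ) * hilbertSeries 𝒜 =
      (((-1) ^ d * X ^ ((M : ℤ) - l).toNat : ℤ[X]) : PowerSeries ℤ) := by
    ext k
    rw [coeffp, Polynomial.coeff_coe]
    have hfd := fun i => finite_homDegree hc hf i ((k : ℤ) - M)
    have hsub : Subsingleton ((resolution hc hf).P (d + 1)) := by
      have := isEmpty_succ hc hf hd 0
      exact inferInstanceAs (Subsingleton ((stage hc hf (d + 1)).ι →₀ A))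
    have h1 := (resolution hc hf).alternating_sum_homDegree ((k : ℤ) - M) hsub
    rw [alternating_sum_ext hl] at h1
    have h2 : ((-1) ^ d * X ^ ((M : ℤ) - l).toNat : ℤ[X]).coeff k =
        if (k : ℤ) - M = -l then (-1) ^ d else 0 := by
      rw [show ((-1) ^ d : ℤ[X]) = C ((-1) ^ d) by simp, coeff_C_mul_X_pow]
      congr 1
      exact propext ⟨fun h => by omega, fun h => by omega⟩
    rw [h2, ← h1]
    refine Finset.sum_congr rfl fun i hi => ?_
    rw [finrank_homDegree]
    congr 2
    refine Finset.sum_congr rfl fun b _ => ?_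
    congr 1
    have := hdeg i hi b
    omega
  refine ⟨p, M, ((M : ℤ) - l).toNat, hpM, hp1, ?_⟩
  rw [hq]
  -- Multiplying `q * H = (-1) ^ d * X ^ k` by `p = 1 / H` isolates `q`.
  apply Polynomial.coe_injective
  rw [Polynomial.coe_mul, ← hq1, mul_assoc, mul_comm (hilbertSeries 𝒜), hp1, mul_one]

end HilbertSeries

/-! ### Zeros of `p`: roots of unity, maximal multiplicity at `1`, and its parity. -/

section RootsOnUnitCircle

open Polynomial Filter Topology

theorem summable_mul_pow_of_le_pow {h : ℕ → ℕ} {c : ℕ} (hc : ∀ᶠ n in atTop, h n ≤ n ^ c) {r : ℝ}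
    (h0 : 0 ≤ r) (h1 : r < 1) : Summable fun n => (h n : ℝ) * r ^ n := by
  refine Summable.of_norm_bounded_eventually_nat (summable_pow_mul_geometric_of_norm_lt_one c
    (r := r) (by rwa [Real.norm_of_nonneg h0])) ?_
  filter_upwards [hc] with n hn
  rw [Real.norm_of_nonneg (by positivity)]
  gcongr
  exact_mod_cast hn

variable {p : ℤ[X]} {h : ℕ → ℕ}

theorem eval_mul_tsum_eq_one
    (hp : (p : PowerSeries ℤ) * PowerSeries.mk (fun n => (h n : ℤ)) = 1)
    (hs : ∀ r : ℝ, 0 ≤ r → r < 1 → Summable fun n => (h n : ℝ) * r ^ n) {z : ℂ} (hz : ‖z‖ < 1) :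
    (p.map (Int.castRingHom ℂ)).eval z * ∑' n, (h n : ℂ) * z ^ n = 1 := by
  have h1 : (p.map (Int.castRingHom ℂ)).eval z = ∑' n, (p.coeff n : ℂ) * z ^ n := by
    rw [tsum_eq_sum (s := Finset.range (p.natDegree + 1)), eval_map, eval₂_eq_sum_range]
    · rfl
    · intro n hn
      rw [coeff_eq_zero_of_natDegree_lt (by simpa using hn)]
      simp
  have hs1 : Summable fun n => ‖(p.coeff n : ℂ) * z ^ n‖ := by
    refine summable_of_ne_finset_zero (s := Finset.range (p.natDegree + 1)) fun n hn => ?_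
    rw [coeff_eq_zero_of_natDegree_lt (by simpa using hn)]
    simp
  have hs2 : Summable fun n => ‖(h n : ℂ) * z ^ n‖ := by
    simpa using hs ‖z‖ (norm_nonneg z) hz
  rw [h1, tsum_mul_tsum_eq_tsum_sum_antidiagonal_of_summable_norm hs1 hs2, tsum_eq_single 0]
  · have := congrArg (PowerSeries.coeff 0) hp
    simp only [PowerSeries.coeff_mul, PowerSeries.coeff_mk, Polynomial.coeff_coe,
      PowerSeries.coeff_one, if_true] at this
    simp only [Finset.Nat.antidiagonal_zero, Finset.sum_singleton, pow_zero, mul_one] at this ⊢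
    exact_mod_cast this
  · intro n hn
    have := congrArg (PowerSeries.coeff n) hp
    simp only [PowerSeries.coeff_mul, PowerSeries.coeff_mk, Polynomial.coeff_coe,
      PowerSeries.coeff_one, if_neg hn] at this
    have h2 : ∑ kl ∈ Finset.HasAntidiagonal.antidiagonal n, (p.coeff kl.1 : ℂ) * (h kl.2 : ℂ) = 0 := by
      exact_mod_cast this
    rw [← zero_mul (z ^ n), ← h2, Finset.sum_mul]
    refine Finset.sum_congr rfl fun kl hkl => ?_
    rw [← Finset.HasAntidiagonal.mem_antidiagonal.1 hkl, pow_add]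
    ring

theorem one_le_norm_eval_mul_tsum
    (hp : (p : PowerSeries ℤ) * PowerSeries.mk (fun n => (h n : ℤ)) = 1)
    (hs : ∀ r : ℝ, 0 ≤ r → r < 1 → Summable fun n => (h n : ℝ) * r ^ n) {z : ℂ} (hz : ‖z‖ < 1) :
    1 ≤ ‖(p.map (Int.castRingHom ℂ)).eval z‖ * ∑' n, (h n : ℝ) * ‖z‖ ^ n := by
  have h1 := congrArg norm (eval_mul_tsum_eq_one hp hs hz)
  rw [norm_mul, norm_one] at h1
  have hs2 : Summable fun n => ‖(h n : ℂ) * z ^ n‖ := by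
    simpa using hs ‖z‖ (norm_nonneg z) hz
  rw [← h1]
  gcongr
  simpa using norm_tsum_le_tsum_norm hs2

theorem norm_eval_ofReal_mul_tsum
    (hp : (p : PowerSeries ℤ) * PowerSeries.mk (fun n => (h n : ℤ)) = 1)
    (hs : ∀ r : ℝ, 0 ≤ r → r < 1 → Summable fun n => (h n : ℝ) * r ^ n) {r : ℝ} (h0 : 0 ≤ r)
    (h1 : r < 1) :
    ‖(p.map (Int.castRingHom ℂ)).eval (r : ℂ)‖ * ∑' n, (h n : ℝ) * r ^ n = 1 := by
  have hr : ‖(r : ℂ)‖ < 1 := by rwa [Complex.norm_real, Real.norm_of_nonneg h0]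
  have h2 := congrArg norm (eval_mul_tsum_eq_one hp hs hr)
  have h3 : ∑' n, (h n : ℂ) * (r : ℂ) ^ n = ((∑' n, (h n : ℝ) * r ^ n : ℝ) : ℂ) := by
    rw [Complex.ofReal_tsum]
    push_cast
    rfl
  rwa [norm_mul, norm_one, h3, Complex.norm_real,
    Real.norm_of_nonneg (tsum_nonneg fun n => by positivity)] at h2

/-- Nonnegative coefficients give `|H(z)| ≤ H(|z|)`; take reciprocals. -/
theorem norm_eval_ofReal_le
    (hp : (p : PowerSeries ℤ) * PowerSeries.mk (fun n => (h n : ℤ)) = 1)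
    (hs : ∀ r : ℝ, 0 ≤ r → r < 1 → Summable fun n => (h n : ℝ) * r ^ n) {z : ℂ} (hz : ‖z‖ < 1) :
    ‖(p.map (Int.castRingHom ℂ)).eval (‖z‖ : ℂ)‖ ≤ ‖(p.map (Int.castRingHom ℂ)).eval z‖ := by
  have h1 := one_le_norm_eval_mul_tsum hp hs hz
  rw [← norm_eval_ofReal_mul_tsum hp hs (norm_nonneg z) hz] at h1
  refine le_of_mul_le_mul_right h1 ?_
  by_contra hneg
  have h2 := norm_eval_ofReal_mul_tsum hp hs (norm_nonneg z) hz
  have := mul_nonpos_of_nonneg_of_nonpos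
    (norm_nonneg ((p.map (Int.castRingHom ℂ)).eval (‖z‖ : ℂ))) (not_lt.1 hneg)
  linarith

theorem coeff_zero_eq_one (hp : (p : PowerSeries ℤ) * PowerSeries.mk (fun n => (h n : ℤ)) = 1) :
    p.coeff 0 = 1 := by
  have := congrArg (PowerSeries.coeff 0) hp
  simp only [PowerSeries.coeff_mul, PowerSeries.coeff_mk, Polynomial.coeff_coe,
    PowerSeries.coeff_one, if_true, Finset.Nat.antidiagonal_zero, Finset.sum_singleton] at this
  rcases Int.mul_eq_one_iff_eq_one_or_neg_one.1 this with h | h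
  · exact h.1
  · have := h.2
    omega

/-- Reflection turns the constant coefficient `1` into the leading coefficient, and the functional
equation compares this with the leading coefficient of `p` up to sign. -/
theorem abs_leadingCoeff_of_reflect {M k d : ℕ} (hM : p.natDegree ≤ M) (h0 : p.coeff 0 = 1)
    (hr : p.reflect M = (-1) ^ d * X ^ k * p) : |p.leadingCoeff| = 1 := by
  have h1 : (p.reflect M).natDegree = M := by
    refine natDegree_eq_of_le_of_coeff_ne_zero ?_ ?_
    · refine (natDegree_reflect_le).trans (max_le le_rfl hM)
    · rw [coeff_reflect, revAt_le le_rfl, Nat.sub_self, h0]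
      exact one_ne_zero
  have h2 : (p.reflect M).leadingCoeff = 1 := by
    rw [leadingCoeff, h1, coeff_reflect, revAt_le le_rfl, Nat.sub_self, h0]
  rw [hr, leadingCoeff_mul, leadingCoeff_mul, leadingCoeff_pow, leadingCoeff_neg, leadingCoeff_one,
    leadingCoeff_X_pow, mul_one] at h2
  have h3 := congrArg abs h2
  rwa [abs_mul, abs_pow, abs_neg, abs_one, one_pow, one_mul] at h3

/-- A zero inside the disc contradicts `p * H = 1`, and the functional equation makes the set of
zeros stable under inversion. -/
theorem norm_eq_one_of_root {M k d : ℕ}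
    (hp : (p : PowerSeries ℤ) * PowerSeries.mk (fun n => (h n : ℤ)) = 1)
    (hs : ∀ r : ℝ, 0 ≤ r → r < 1 → Summable fun n => (h n : ℝ) * r ^ n) (hM : p.natDegree ≤ M)
    (hr : p.reflect M = (-1) ^ d * X ^ k * p) {z : ℂ}
    (hz : (p.map (Int.castRingHom ℂ)).eval z = 0) : ‖z‖ = 1 := by
  have key : ∀ w : ℂ, (p.map (Int.castRingHom ℂ)).eval w = 0 → 1 ≤ ‖w‖ := by
    intro w hw
    by_contra hlt
    have := eval_mul_tsum_eq_one hp hs (not_le.1 hlt)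
    rw [hw, zero_mul] at this
    exact zero_ne_one this
  refine le_antisymm ?_ (key z hz)
  have hz0 : z ≠ 0 := by
    rintro rfl
    have := key 0 hz
    simp at this
    linarith
  have hinv : (p.map (Int.castRingHom ℂ)).eval z⁻¹ = 0 := by
    let _ : Invertible z := invertibleOfNonzero hz0
    have h1 := (eval₂_reflect_eq_zero_iff (Int.castRingHom ℂ) z M p hM).2 (by rwa [← eval_map])
    rw [hr, invOf_eq_inv] at h1
    simp only [eval₂_mul, eval₂_pow, eval₂_neg, eval₂_one, eval₂_X, mul_eq_zero, pow_eq_zero_iff',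
      neg_eq_zero, one_ne_zero, inv_eq_zero, hz0, false_and, false_or] at h1
    rwa [eval_map]
  have := key _ hinv
  rw [norm_inv] at this
  exact (one_le_inv₀ (norm_pos_iff.2 hz0)).1 this

/-- The order of a polynomial at `1` is its maximal order at a root if the inverse power series has
nonnegative coefficients. -/
theorem rootMultiplicity_le
    (hp : (p : PowerSeries ℤ) * PowerSeries.mk (fun n => (h n : ℤ)) = 1)
    (hs : ∀ r : ℝ, 0 ≤ r → r < 1 → Summable fun n => (h n : ℝ) * r ^ n) {ζ : ℂ} (hζ : ‖ζ‖ = 1) :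
    (p.map (Int.castRingHom ℂ)).rootMultiplicity ζ ≤
      (p.map (Int.castRingHom ℂ)).rootMultiplicity 1 := by
  set P := p.map (Int.castRingHom ℂ) with hP
  have hP0 : P ≠ 0 := by
    intro h0
    have := eval_mul_tsum_eq_one hp hs (z := 0) (by simp)
    rw [← hP, h0] at this
    simp at this
  obtain ⟨q, hq, -⟩ := exists_eq_pow_rootMultiplicity_mul_and_not_dvd P hP0 ζ
  obtain ⟨q', hq', hq'1⟩ := exists_eq_pow_rootMultiplicity_mul_and_not_dvd P hP0 1
  set k := P.rootMultiplicity ζ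
  set m := P.rootMultiplicity 1
  by_contra! hlt
  -- Comparing `|p(r)| ≤ |p(r * ζ)|` after cancelling `(1 - r) ^ m`. If `k > m`, letting `r → 1`
  -- gives `q' 1 = 0`, against the choice of `m`.
  have hbound : ∀ r : ℝ, 0 < r → r < 1 →
      ‖q'.eval (r : ℂ)‖ ≤ (1 - r) ^ (k - m) * ‖q.eval (r * ζ : ℂ)‖ := by
    intro r h0 h1
    have hn : ‖(r * ζ : ℂ)‖ = r := by
      rw [norm_mul, hζ, mul_one, Complex.norm_real, Real.norm_of_nonneg h0.le]
    have h2 := norm_eval_ofReal_le hp hs (z := r * ζ) (by rwa [hn])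
    rw [← hP, hn] at h2
    conv_lhs at h2 => rw [hq']
    conv_rhs at h2 => rw [hq]
    have e1 : ‖(r : ℂ) - 1‖ = 1 - r := by
      rw [← Complex.ofReal_one, ← Complex.ofReal_sub, Complex.norm_real, Real.norm_eq_abs,
        abs_sub_comm, abs_of_pos (by linarith)]
    have e2 : ‖(r : ℂ) * ζ - ζ‖ = 1 - r := by
      rw [← sub_one_mul, norm_mul, e1, hζ, mul_one]
    simp only [eval_mul, eval_pow, eval_sub, eval_X, eval_C, norm_mul, norm_pow, e1, e2] at h2
    rw [← Nat.add_sub_of_le hlt.le, pow_add, mul_assoc] at h2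
    exact le_of_mul_le_mul_left h2 (pow_pos (by linarith) m)
  have hcont1 : Tendsto (fun r : ℝ => ‖q'.eval (r : ℂ)‖) (𝓝[<] 1) (𝓝 ‖q'.eval (1 : ℂ)‖) := by
    have : Continuous fun r : ℝ => ‖q'.eval (r : ℂ)‖ := by fun_prop
    simpa using (this.tendsto 1).mono_left nhdsWithin_le_nhds
  have hcont2 : Tendsto (fun r : ℝ => (1 - r) ^ (k - m) * ‖q.eval (r * ζ : ℂ)‖) (𝓝[<] 1)
      (𝓝 0) := by
    have : Continuous fun r : ℝ => (1 - r) ^ (k - m) * ‖q.eval (r * ζ : ℂ)‖ := by fun_prop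
    have h2 := (this.tendsto 1).mono_left (nhdsWithin_le_nhds (s := Set.Iio 1))
    rwa [sub_self, zero_pow (by omega), zero_mul] at h2
  have hle := le_of_tendsto_of_tendsto hcont1 hcont2 (by
    filter_upwards [Ioo_mem_nhdsLT (zero_lt_one' ℝ)] with r hr using hbound r hr.1 hr.2)
  apply hq'1
  rw [dvd_iff_isRoot]
  exact norm_le_zero_iff.1 hle

/-- Kronecker's theorem in terms of the Mahler measure, which is `1` because the leading coefficient
is `±1` and all zeros lie on the unit circle. A common exponent `N` is a product over the distinct
zeros. -/
theorem exists_pow_eq_one_of_root {M k d : ℕ}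
    (hp : (p : PowerSeries ℤ) * PowerSeries.mk (fun n => (h n : ℤ)) = 1)
    (hs : ∀ r : ℝ, 0 ≤ r → r < 1 → Summable fun n => (h n : ℝ) * r ^ n) (hM : p.natDegree ≤ M)
    (hr : p.reflect M = (-1) ^ d * X ^ k * p) :
    ∃ N, 0 < N ∧ ∀ z ∈ (p.map (Int.castRingHom ℂ)).roots, z ^ N = 1 := by
  set P := p.map (Int.castRingHom ℂ) with hP
  have hnorm : ∀ z ∈ P.roots, ‖z‖ = 1 := fun z hz =>
    norm_eq_one_of_root hp hs hM hr (isRoot_of_mem_roots hz)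
  have hmahler : P.mahlerMeasure = 1 := by
    rw [mahlerMeasure_eq_leadingCoeff_mul_prod_roots, hP,
      leadingCoeff_map_of_injective (Int.castRingHom ℂ).injective_int, ← hP,
      Multiset.prod_eq_one, mul_one]
    · have := abs_leadingCoeff_of_reflect hM (coeff_zero_eq_one hp) hr
      rw [eq_intCast, Complex.norm_intCast]
      exact_mod_cast this
    · intro x hx
      obtain ⟨z, hz, rfl⟩ := Multiset.mem_map.1 hx
      rw [hnorm z hz, max_self]
  have hroot : ∀ z ∈ P.roots, ∃ n, 0 < n ∧ z ^ n = 1 := by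
    intro z hz
    refine pow_eq_one_of_mahlerMeasure_eq_one hmahler ?_ hz
    rintro rfl
    simpa using hnorm 0 hz
  choose! n hn0 hn1 using hroot
  refine ⟨∏ z ∈ P.roots.toFinset, n z,
    Finset.prod_pos fun z hz => hn0 z (Multiset.mem_toFinset.1 hz), fun z hz => ?_⟩
  obtain ⟨c, hc⟩ := Finset.dvd_prod_of_mem n (Multiset.mem_toFinset.2 hz)
  rw [hc, pow_mul, hn1 z hz, one_pow]

theorem dvd_one_sub_X_pow_pow {M k d : ℕ}
    (hp : (p : PowerSeries ℤ) * PowerSeries.mk (fun n => (h n : ℤ)) = 1)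
    (hs : ∀ r : ℝ, 0 ≤ r → r < 1 → Summable fun n => (h n : ℝ) * r ^ n) (hM : p.natDegree ≤ M)
    (hr : p.reflect M = (-1) ^ d * X ^ k * p) :
    ∃ N, 0 < N ∧ p.map (Int.castRingHom ℂ) ∣
      (1 - X ^ N) ^ (p.map (Int.castRingHom ℂ)).rootMultiplicity 1 := by
  classical
  obtain ⟨N, hN, hroots⟩ := exists_pow_eq_one_of_root hp hs hM hr
  refine ⟨N, hN, ?_⟩
  set P := p.map (Int.castRingHom ℂ) with hP
  have hP0 : P ≠ 0 := by
    intro h0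
    have := eval_mul_tsum_eq_one hp hs (z := 0) (by simp)
    rw [← hP, h0] at this
    simp at this
  have hX : (1 - X ^ N : ℂ[X]) ≠ 0 := by
    rw [← neg_ne_zero, neg_sub]
    exact X_pow_sub_C_ne_zero hN 1
  rw [IsAlgClosed.dvd_iff_roots_le_roots hP0 (pow_ne_zero _ hX), Multiset.le_iff_count]
  intro z
  rw [count_roots]
  by_cases hz : z ∈ P.roots
  · rw [roots_pow, Multiset.count_nsmul, count_roots]
    refine (rootMultiplicity_le hp hs
      (norm_eq_one_of_root hp hs hM hr (isRoot_of_mem_roots hz))).trans ?_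
    refine Nat.le_mul_of_pos_right _ ((rootMultiplicity_pos hX).2 ?_)
    simp [hroots z hz]
  · rw [rootMultiplicity_eq_zero fun h => hz ((mem_roots hP0).2 h)]
    exact Nat.zero_le _

/-- Write `p = (X - 1) ^ m * q` with `q 1 ≠ 0`. Reflection multiplies `(X - 1) ^ m` by `(-1) ^ m`
and preserves the value of the cofactor at `1`, so the functional equation evaluated there leaves
`(-1) ^ d = (-1) ^ m`. -/
theorem modEq_rootMultiplicity {M k d : ℕ} (hp0 : p ≠ 0) (hM : p.natDegree ≤ M)
    (hr : p.reflect M = (-1) ^ d * X ^ k * p) :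
    (p.map (Int.castRingHom ℂ)).rootMultiplicity 1 ≡ d [MOD 2] := by
  set P := p.map (Int.castRingHom ℂ) with hP
  have hP0 : P ≠ 0 := (Polynomial.map_ne_zero_iff (Int.castRingHom ℂ).injective_int).2 hp0
  obtain ⟨q, hq, hq1⟩ := exists_eq_pow_rootMultiplicity_mul_and_not_dvd P hP0 1
  set m := P.rootMultiplicity 1
  have hX : (X - C 1 : ℂ[X]) ≠ 0 := X_sub_C_ne_zero 1
  have hq0 : q ≠ 0 := by
    rintro rfl
    exact hq1 (dvd_zero _)
  have hdeg : m + q.natDegree = P.natDegree := by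
    conv_rhs => rw [hq, natDegree_mul (pow_ne_zero _ hX) hq0, natDegree_pow, natDegree_X_sub_C]
    omega
  have hPM : P.natDegree ≤ M := natDegree_map_le.trans hM
  have hPr : P.reflect M = (-1) ^ d * X ^ k * P := by
    rw [hP, reflect_map, hr]
    simp
  have hpow : ∀ n, ((X - C 1 : ℂ[X]) ^ n).reflect n = (-1) ^ n * (X - C 1) ^ n := by
    intro n
    induction n with
    | zero => simp
    | succ n ih =>
      rw [pow_succ, reflect_mul _ _ (by rw [natDegree_pow, natDegree_X_sub_C, mul_one])
        (natDegree_X_sub_C 1).le, ih]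
      have : (X - C 1 : ℂ[X]).reflect 1 = -(X - C 1) := by
        rw [sub_eq_add_neg, reflect_add, reflect_neg, reflect_C]
        have := reflect_monomial (R := ℂ) 1 1
        rw [pow_one, revAt_le le_rfl] at this
        rw [this]
        simp
      rw [this]
      ring
  have h1 : P.reflect M = (-1) ^ m * (X - C 1) ^ m * q.reflect (M - m) := by
    conv_lhs => rw [hq, show M = m + (M - m) by omega]
    rw [reflect_mul _ _ (by rw [natDegree_pow, natDegree_X_sub_C, mul_one]) (by omega), hpow]
  rw [hPr] at h1
  conv_lhs at h1 => rw [hq]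
  have h2 : (-1) ^ d * X ^ k * q = (-1) ^ m * q.reflect (M - m) := by
    refine mul_left_cancel₀ (pow_ne_zero m hX) ?_
    linear_combination h1
  have h3 : (q.reflect (M - m)).eval 1 = q.eval 1 := by
    let _ : Invertible (1 : ℂ) := invertibleOne
    have := eval₂_reflect_mul_pow (RingHom.id ℂ) 1 (M - m) q (by omega)
    simpa using this
  have h4 := congrArg (eval 1) h2
  simp only [eval_mul, eval_pow, eval_neg, eval_one, eval_X, one_pow, mul_one, h3] at h4
  have hqe : q.eval 1 ≠ 0 := fun h => hq1 (dvd_iff_isRoot.2 h)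
  have h5 := mul_right_cancel₀ hqe h4
  rcases Nat.even_or_odd d with hd | hd <;> rcases Nat.even_or_odd m with hm | hm
  · exact (Nat.even_iff.1 hm).trans (Nat.even_iff.1 hd).symm
  · rw [hd.neg_one_pow, hm.neg_one_pow] at h5
    norm_num at h5
  · rw [hd.neg_one_pow, hm.neg_one_pow] at h5
    norm_num at h5
  · exact (Nat.odd_iff.1 hm).trans (Nat.odd_iff.1 hd).symm

end RootsOnUnitCircle

/-! ### Growth of the partial sums of the coefficients of `1 / p`. -/

section Growth

open Polynomial Filter Topology

/-- Dividing by `1 - X ^ N` raises the growth exponent by at most one. The recursion `F_n = G_n +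
F_(n-N)` keeps the same constant, since `(n + 1) ^ k + n * (n + 1) ^ k = (n + 1) ^ (k + 1)`. -/
theorem norm_coeff_le_of_mul_one_sub_X_pow {F G : PowerSeries ℂ} {N k : ℕ} (hN : 0 < N) {c : ℝ}
    (hc : 0 ≤ c) (hFG : F * (1 - PowerSeries.X ^ N) = G)
    (hG : ∀ n, ‖PowerSeries.coeff n G‖ ≤ c * (n + 1) ^ k) (n : ℕ) :
    ‖PowerSeries.coeff n F‖ ≤ c * (n + 1) ^ (k + 1) := by
  induction n using Nat.strong_induction_on with
  | _ n ih =>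
    have h1 := congrArg (PowerSeries.coeff n) hFG
    rw [mul_sub, mul_one, map_sub, PowerSeries.coeff_mul_X_pow'] at h1
    have hGn := hG n
    split_ifs at h1 with hn
    · have h2 := ih (n - N) (by omega)
      have h3 : ((n - N : ℕ) : ℝ) + 1 ≤ n := by exact_mod_cast (by omega : n - N + 1 ≤ n)
      have h4 : ((n - N : ℕ) + 1 : ℝ) ^ (k + 1) ≤ n * ((n : ℝ) + 1) ^ k := by
        rw [pow_succ, mul_comm]
        exact mul_le_mul h3 (pow_le_pow_left₀ (by positivity) (by linarith) k) (by positivity)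
          (by positivity)
      calc ‖PowerSeries.coeff n F‖
          = ‖PowerSeries.coeff n G + PowerSeries.coeff (n - N) F‖ := by rw [← h1]; ring_nf
        _ ≤ c * (n + 1) ^ k + c * (((n - N : ℕ) : ℝ) + 1) ^ (k + 1) :=
          (norm_add_le _ _).trans (add_le_add hGn h2)
        _ ≤ c * (n + 1) ^ k + c * (n * ((n : ℝ) + 1) ^ k) := by gcongr
        _ = c * (n + 1) ^ (k + 1) := by ring
    · rw [sub_zero] at h1
      rw [h1]
      refine hGn.trans ?_
      gcongr
      · linarith [n.cast_nonneg (α := ℝ)]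
      · omega

theorem norm_coeff_le_of_mul_one_sub_X_pow_pow {F G : PowerSeries ℂ} {N m : ℕ} (hN : 0 < N)
    {c : ℝ} (hc : 0 ≤ c) (hFG : F * (1 - PowerSeries.X ^ N) ^ m = G)
    (hG : ∀ n, ‖PowerSeries.coeff n G‖ ≤ c) (n : ℕ) :
    ‖PowerSeries.coeff n F‖ ≤ c * (n + 1) ^ m := by
  induction m generalizing F n with
  | zero =>
    rw [pow_zero, mul_one] at hFG
    simpa [hFG] using hG n
  | succ m ih =>
    refine norm_coeff_le_of_mul_one_sub_X_pow hN hc rfl (fun n => ih ?_ n) n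
    rw [mul_assoc, ← pow_succ', hFG]

variable {p : ℤ[X]} {h : ℕ → ℕ}

/-- The partial sums are the coefficients of `H / (1 - X)`. Multiplied by `(1 - X ^ N) ^ m` this
becomes `q / (1 - X)` with `q` a polynomial, whose coefficients are bounded by the sum of the
`‖q.coeff i‖`. -/
theorem exists_sum_le_mul_pow {N m : ℕ}
    (hp : (p : PowerSeries ℤ) * PowerSeries.mk (fun n => (h n : ℤ)) = 1) (hN : 0 < N)
    (hdvd : p.map (Int.castRingHom ℂ) ∣ (1 - X ^ N) ^ m) :
    ∃ c : ℝ, 0 ≤ c ∧ ∀ n : ℕ, ((∑ i ∈ Finset.range (n + 1), h i : ℕ) : ℝ) ≤ c * (n + 1) ^ m := by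
  obtain ⟨q, hq⟩ := hdvd
  set H : PowerSeries ℂ := PowerSeries.mk fun n => (h n : ℂ)
  have hH : ((p.map (Int.castRingHom ℂ) : ℂ[X]) : PowerSeries ℂ) * H = 1 := by
    have h1 := congrArg (PowerSeries.map (Int.castRingHom ℂ)) hp
    rw [map_mul, map_one, ← Polynomial.polynomial_map_coe] at h1
    rw [← h1]
    congr 1
  have hHq : H * (1 - PowerSeries.X ^ N) ^ m = (q : PowerSeries ℂ) := by
    have h1 : (((1 - X ^ N) ^ m : ℂ[X]) : PowerSeries ℂ) = (1 - PowerSeries.X ^ N) ^ m := by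
      simp
    rw [← h1, hq, Polynomial.coe_mul, ← mul_assoc, mul_comm H, hH, one_mul]
  have hcoeff : ∀ (f : PowerSeries ℂ) n, PowerSeries.coeff n (f * PowerSeries.mk 1) =
      ∑ i ∈ Finset.range (n + 1), PowerSeries.coeff i f := by
    intro f n
    rw [PowerSeries.coeff_mul, Finset.Nat.sum_antidiagonal_eq_sum_range_succ_mk]
    simp
  refine ⟨∑ i ∈ Finset.range (q.natDegree + 1), ‖q.coeff i‖,
    Finset.sum_nonneg fun _ _ => norm_nonneg _, fun n => ?_⟩
  have key := norm_coeff_le_of_mul_one_sub_X_pow_pow (F := H * PowerSeries.mk 1)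
    (G := (q : PowerSeries ℂ) * PowerSeries.mk 1) (m := m) hN
    (Finset.sum_nonneg fun (i : ℕ) (_ : i ∈ Finset.range (q.natDegree + 1)) =>
      norm_nonneg (q.coeff i)) (by rw [← hHq]; ring) (fun n => ?_) n
  · rw [hcoeff] at key
    have h2 : ∑ i ∈ Finset.range (n + 1), PowerSeries.coeff i H =
        ((∑ i ∈ Finset.range (n + 1), h i : ℕ) : ℂ) := by
      rw [Nat.cast_sum]
      exact Finset.sum_congr rfl fun i _ => PowerSeries.coeff_mk _ _
    rwa [h2, Complex.norm_natCast] at key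
  · rw [hcoeff]
    refine (norm_sum_le _ _).trans ?_
    simp only [Polynomial.coeff_coe]
    rcases le_total (n + 1) (q.natDegree + 1) with hn | hn
    · exact Finset.sum_le_sum_of_subset_of_nonneg (Finset.range_mono hn)
        fun _ _ _ => norm_nonneg _
    · refine (Finset.sum_subset (Finset.range_mono hn) fun i _ hi => ?_).ge
      rw [coeff_eq_zero_of_natDegree_lt (by simpa using hi), norm_zero]

/-- Split at `n + 1 = N`. Below, `(n + 1) ^ s ≤ N ^ s`. Above, `(n + 1) ^ s ≤ N ^ (s - m) * (n + 1)
^ m`, and `(n + 1) ^ m ≤ m! * (n + m).choose m`, whose generating function at `r = 1 - 1 / N` is `N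
^ (m + 1)`. -/
theorem tsum_rpow_mul_pow_le {s : ℝ} {m N : ℕ} (hs0 : 0 ≤ s) (hsm : s ≤ m) (hN : 0 < N) :
    (Summable fun n : ℕ => ((n : ℝ) + 1) ^ s * (1 - (N : ℝ)⁻¹) ^ n) ∧
    ∑' n : ℕ, ((n : ℝ) + 1) ^ s * (1 - (N : ℝ)⁻¹) ^ n ≤ (m.factorial + 1) * (N : ℝ) ^ (s + 1) := by
  have hN' : (0 : ℝ) < N := by exact_mod_cast hN
  have hN1 : (N : ℝ)⁻¹ ≤ 1 := inv_le_one_of_one_le₀ (by exact_mod_cast hN)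
  set r : ℝ := 1 - (N : ℝ)⁻¹ with hr
  have hr0 : 0 ≤ r := by linarith
  have hr1 : ‖r‖ < 1 := by
    rw [Real.norm_of_nonneg hr0, hr]
    linarith [inv_pos.2 hN']
  have h1r : 1 - r = (N : ℝ)⁻¹ := by rw [hr]; ring
  have hgeo := hasSum_geometric_of_norm_lt_one hr1
  have hchoose := hasSum_choose_mul_geometric_of_norm_lt_one m hr1
  rw [h1r, inv_inv] at hgeo
  rw [h1r, inv_pow, one_div, inv_inv] at hchoose
  have hsum := (hchoose.mul_left ((N : ℝ) ^ (s - m) * m.factorial)).add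
    (hgeo.mul_left ((N : ℝ) ^ s))
  have hle : ∀ n : ℕ, ((n : ℝ) + 1) ^ s * r ^ n ≤
      (N : ℝ) ^ (s - m) * m.factorial * (((n + m).choose m : ℝ) * r ^ n) + (N : ℝ) ^ s * r ^ n := by
    intro n
    rw [← mul_assoc, ← add_mul]
    refine mul_le_mul_of_nonneg_right ?_ (pow_nonneg hr0 n)
    have hn1 : (0 : ℝ) < (n : ℝ) + 1 := by positivity
    rcases le_total ((n : ℝ) + 1) N with hn | hn
    · have : ((n : ℝ) + 1) ^ s ≤ (N : ℝ) ^ s := Real.rpow_le_rpow hn1.le hn hs0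
      have : 0 ≤ (N : ℝ) ^ (s - m) * m.factorial * ((n + m).choose m : ℝ) := by positivity
      linarith
    · have e1 : ((n : ℝ) + 1) ^ s = ((n : ℝ) + 1) ^ (s - m) * ((n : ℝ) + 1) ^ m := by
        rw [← Real.rpow_natCast, ← Real.rpow_add hn1, sub_add_cancel]
      have e2 : ((n : ℝ) + 1) ^ (s - m) ≤ (N : ℝ) ^ (s - m) :=
        Real.rpow_le_rpow_of_nonpos hN' hn (by linarith)
      have e3 : ((n : ℝ) + 1) ^ m ≤ m.factorial * ((n + m).choose m : ℝ) := by
        have := Nat.pow_succ_le_ascFactorial (n + 1) m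
        rw [Nat.ascFactorial_eq_factorial_mul_choose] at this
        exact_mod_cast this
      have e4 : (0 : ℝ) ≤ (N : ℝ) ^ s := by positivity
      rw [e1]
      have := mul_le_mul e2 e3 (by positivity) (by positivity)
      linarith
  have hsummable : Summable fun n : ℕ => ((n : ℝ) + 1) ^ s * r ^ n :=
    Summable.of_nonneg_of_le (fun n => by positivity) hle hsum.summable
  refine ⟨hsummable, (hsummable.tsum_le_tsum hle hsum.summable).trans ?_⟩
  rw [hsum.tsum_eq]
  have e1 : (N : ℝ) ^ (s - m) * (N : ℝ) ^ (m + 1) = (N : ℝ) ^ (s + 1) := by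
    rw [← Real.rpow_natCast, ← Real.rpow_add hN']
    congr 1
    push_cast
    ring
  have e2 : (N : ℝ) ^ s * N = (N : ℝ) ^ (s + 1) := by rw [Real.rpow_add_one hN'.ne']
  rw [e2, mul_right_comm, e1]
  apply le_of_eq
  ring

/-- The partial sums of the coefficients of `1 / p` grow at least like `n ^ m`, where `m` is the
order of `p` at `1`. -/
theorem not_eventually_sum_le_rpow
    (hp : (p : PowerSeries ℤ) * PowerSeries.mk (fun n => (h n : ℤ)) = 1)
    (hs : ∀ r : ℝ, 0 ≤ r → r < 1 → Summable fun n => (h n : ℝ) * r ^ n) {s : ℝ} (hs0 : 0 ≤ s)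
    (hsm : s < (p.map (Int.castRingHom ℂ)).rootMultiplicity 1) :
    ¬ ∀ᶠ n : ℕ in atTop, ((∑ i ∈ Finset.range (n + 1), h i : ℕ) : ℝ) ≤ (n : ℝ) ^ s := by
  intro hev
  set P := p.map (Int.castRingHom ℂ) with hP
  have hP0 : P ≠ 0 := by
    intro h0
    have := eval_mul_tsum_eq_one hp hs (z := 0) (by simp)
    rw [← hP, h0] at this
    simp at this
  obtain ⟨q, hq, -⟩ := exists_eq_pow_rootMultiplicity_mul_and_not_dvd P hP0 1
  set m := P.rootMultiplicity 1
  obtain ⟨B, hB⟩ := (isCompact_Icc (a := (0 : ℝ)) (b := 1)).exists_bound_of_continuousOn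
    (f := fun r : ℝ => q.eval (r : ℂ)) (by fun_prop)
  have hB0 : 0 ≤ B := (norm_nonneg _).trans (hB 0 ⟨le_rfl, zero_le_one⟩)
  let S : ℕ → ℕ := fun n => ∑ i ∈ Finset.range (n + 1), h i
  obtain ⟨c, hc0, hc⟩ : ∃ c : ℝ, 0 ≤ c ∧ ∀ n : ℕ, (S n : ℝ) ≤ c * ((n : ℝ) + 1) ^ s := by
    obtain ⟨n₀, hn₀⟩ := eventually_atTop.1 hev
    refine ⟨1 + S n₀, by positivity, fun n => ?_⟩
    have h1 : (1 : ℝ) ≤ ((n : ℝ) + 1) ^ s :=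
      Real.one_le_rpow (by linarith [n.cast_nonneg (α := ℝ)]) hs0
    rcases le_total n₀ n with hn | hn
    · calc (S n : ℝ) ≤ (n : ℝ) ^ s := hn₀ n hn
        _ ≤ ((n : ℝ) + 1) ^ s := Real.rpow_le_rpow (by positivity) (by linarith) hs0
        _ ≤ (1 + S n₀) * ((n : ℝ) + 1) ^ s :=
          le_mul_of_one_le_left (by positivity) (by linarith [(S n₀).cast_nonneg (α := ℝ)])
    · have h2 : S n ≤ S n₀ := Finset.sum_le_sum_of_subset (Finset.range_mono (by omega))
      calc (S n : ℝ) ≤ S n₀ := by exact_mod_cast h2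
        _ ≤ 1 + S n₀ := by linarith
        _ ≤ (1 + S n₀) * ((n : ℝ) + 1) ^ s := le_mul_of_one_le_right (by positivity) h1
  -- Evaluate `p * H = 1` at `r = 1 - 1 / N`: the zero of order `m` gives `|p(r)| ≤ B * N ^ (-m)`,
  -- and the assumed growth gives `H(r) ≤ const * N ^ s`. The product tends to `0` as `s < m`.
  have key : ∀ N : ℕ, 0 < N → 1 ≤ B * c * (m.factorial + 1) * (N : ℝ) ^ (s - m) := by
    intro N hN
    have hN' : (0 : ℝ) < N := by exact_mod_cast hN
    have hN1 : (N : ℝ)⁻¹ ≤ 1 := inv_le_one_of_one_le₀ (by exact_mod_cast hN)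
    obtain ⟨hsummable, htsum⟩ := tsum_rpow_mul_pow_le hs0 hsm.le hN
    set r : ℝ := 1 - (N : ℝ)⁻¹ with hr
    have hr0 : 0 ≤ r := by linarith
    have hr1 : r < 1 := by
      rw [hr]
      linarith [inv_pos.2 hN']
    have h1r : 1 - r = (N : ℝ)⁻¹ := by rw [hr]; ring
    have h1 := norm_eval_ofReal_mul_tsum hp hs hr0 hr1
    have h2 : ‖P.eval (r : ℂ)‖ ≤ ((N : ℝ)⁻¹) ^ m * B := by
      conv_lhs => rw [hq]
      have e1 : ‖(r : ℂ) - 1‖ = (N : ℝ)⁻¹ := by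
        rw [← Complex.ofReal_one, ← Complex.ofReal_sub, Complex.norm_real, Real.norm_eq_abs,
          abs_sub_comm, h1r, abs_of_pos (by positivity)]
      simp only [eval_mul, eval_pow, eval_sub, eval_X, eval_C, norm_mul, norm_pow, e1]
      gcongr
      exact hB r ⟨hr0, hr1.le⟩
    have h3 : ∑' n, (h n : ℝ) * r ^ n ≤ (N : ℝ)⁻¹ * (c * ((m.factorial + 1) *
        (N : ℝ) ^ (s + 1))) := by
      have hgeo : Summable fun n : ℕ => ‖r ^ n‖ :=
        (summable_geometric_of_lt_one hr0 hr1).norm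
      -- Multiplying `H(r)` by the geometric series `1 / (1 - r) = N` turns the coefficients into
      -- the partial sums `S n`.
      have hprod := tsum_mul_tsum_eq_tsum_sum_range_of_summable_norm (hs r hr0 hr1).norm hgeo
      have hterm : ∀ n, ∑ i ∈ Finset.range (n + 1), (h i : ℝ) * r ^ i * r ^ (n - i) =
          S n * r ^ n := by
        intro n
        rw [Nat.cast_sum, Finset.sum_mul]
        refine Finset.sum_congr rfl fun i hi => ?_
        rw [mul_assoc, ← pow_add, Nat.add_sub_of_le (Finset.mem_range_succ_iff.1 hi)]
      simp only [hterm] at hprod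
      rw [tsum_geometric_of_lt_one hr0 hr1, h1r, inv_inv] at hprod
      have hle : ∀ n, (S n : ℝ) * r ^ n ≤ c * (((n : ℝ) + 1) ^ s * r ^ n) := fun n => by
        rw [← mul_assoc]
        exact mul_le_mul_of_nonneg_right (hc n) (pow_nonneg hr0 n)
      have hS : Summable fun n => (S n : ℝ) * r ^ n :=
        Summable.of_nonneg_of_le (fun n => by positivity) hle (hsummable.mul_left c)
      have h4 : ∑' n, (S n : ℝ) * r ^ n ≤ c * ((m.factorial + 1) * (N : ℝ) ^ (s + 1)) := by
        refine (hS.tsum_le_tsum hle (hsummable.mul_left c)).trans ?_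
        rw [tsum_mul_left]
        gcongr
      rw [← hprod] at h4
      calc ∑' n, (h n : ℝ) * r ^ n = (N : ℝ)⁻¹ * ((∑' n, (h n : ℝ) * r ^ n) * N) := by
            field_simp
        _ ≤ _ := by gcongr
    have h5 : (N : ℝ) ^ (s - m) = ((N : ℝ)⁻¹) ^ m * ((N : ℝ)⁻¹ * (N : ℝ) ^ (s + 1)) := by
      rw [Real.rpow_sub hN', Real.rpow_add_one hN'.ne', Real.rpow_natCast, inv_pow]
      field_simp
    calc 1 = ‖P.eval (r : ℂ)‖ * ∑' n, (h n : ℝ) * r ^ n := h1.symm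
      _ ≤ ((N : ℝ)⁻¹) ^ m * B * ((N : ℝ)⁻¹ * (c * ((m.factorial + 1) *
        (N : ℝ) ^ (s + 1)))) := by
          gcongr
      _ = _ := by
        rw [h5]
        ring
  have hlim : Tendsto (fun N : ℕ => B * c * (m.factorial + 1) * (N : ℝ) ^ (s - m)) atTop
      (𝓝 (B * c * (m.factorial + 1) * 0)) := by
    refine Tendsto.const_mul _ ?_
    have := (tendsto_rpow_neg_atTop (y := m - s) (by linarith)).comp
      (tendsto_natCast_atTop_atTop (R := ℝ))
    simpa [Function.comp_def] using this
  rw [mul_zero] at hlim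
  have := ge_of_tendsto hlim (b := 1) (by
    filter_upwards [eventually_gt_atTop 0] with N hN using key N hN)
  linarith

end Growth

/-! ### Gelfand-Kirillov dimension in terms of the Hilbert function. -/

section GKDimension

open Filter Topology

variable {K : Type v} {A : Type u} [Field K] [Ring A] [Algebra K A]
variable (𝒜 : ℕ → Submodule K A) [GradedAlgebra 𝒜]

theorem pow_le_component (n : ℕ) : 𝒜 1 ^ n ≤ 𝒜 n := by
  induction n with
  | zero =>
    rw [pow_zero, Submodule.one_le]
    exact SetLike.GradedOne.one_mem (A := 𝒜)
  | succ n ih =>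
    rw [pow_succ, Submodule.mul_le]
    intro a ha b hb
    exact SetLike.mul_mem_graded (ih ha) hb

/-- `A` is spanned by products of elements of degree one; the projection to degree `n` keeps the
products with `n` factors and kills the others. -/
theorem component_eq_pow {𝒜} [GradedAlgebra 𝒜] (h : IsGeneratedInDegreeOne (K := K) (A := A) 𝒜)
    (n : ℕ) : 𝒜 n = 𝒜 1 ^ n := by
  refine le_antisymm (fun a ha => ?_) (pow_le_component 𝒜 n)
  have key : ∀ x : A, GradedAlgebra.proj 𝒜 n x ∈ 𝒜 1 ^ n := by
    intro x
    have hx : x ∈ Subalgebra.toSubmodule (Algebra.adjoin K (𝒜 1 : Set A)) := by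
      have h' : Algebra.adjoin K (𝒜 1 : Set A) = ⊤ := h
      rw [h']
      trivial
    rw [Algebra.adjoin_eq_span] at hx
    induction hx using Submodule.span_induction with
    | zero => rw [map_zero]; exact zero_mem _
    | add x y _ _ hx hy => rw [map_add]; exact add_mem hx hy
    | smul c x _ hx => rw [map_smul]; exact Submodule.smul_mem _ c hx
    | mem x hx =>
      have hk : ∃ k, x ∈ 𝒜 1 ^ k := by
        induction hx using Submonoid.closure_induction with
        | mem x hx => exact ⟨1, by rwa [pow_one]⟩
        | one => exact ⟨0, by rw [pow_zero]; exact Submodule.one_le.1 le_rfl⟩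
        | mul x y _ _ hx hy =>
          obtain ⟨i, hi⟩ := hx
          obtain ⟨j, hj⟩ := hy
          exact ⟨i + j, by rw [pow_add]; exact Submodule.mul_mem_mul hi hj⟩
      obtain ⟨k, hk⟩ := hk
      rw [GradedAlgebra.proj_apply]
      by_cases hkn : k = n
      · subst hkn
        rwa [DirectSum.decompose_of_mem_same 𝒜 (pow_le_component 𝒜 k hk)]
      · rw [DirectSum.decompose_of_mem_ne 𝒜 (pow_le_component 𝒜 k hk) hkn]
        exact zero_mem _
  have := key a
  rwa [GradedAlgebra.proj_apply, DirectSum.decompose_of_mem_same 𝒜 ha] at this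

/-- The elements of degree at most `n`. -/
def degreeLE (n : ℕ) : Submodule K A := ⨆ i ∈ Finset.range (n + 1), 𝒜 i

theorem le_degreeLE {i n : ℕ} (h : i ≤ n) : 𝒜 i ≤ degreeLE 𝒜 n :=
  le_iSup₂_of_le i (by simpa using h) le_rfl

theorem degreeLE_mono {m n : ℕ} (h : m ≤ n) : degreeLE 𝒜 m ≤ degreeLE 𝒜 n :=
  iSup₂_le fun _ hi => le_degreeLE 𝒜 (by rw [Finset.mem_range] at hi; omega)

theorem one_le_degreeLE (n : ℕ) : 1 ≤ degreeLE 𝒜 n := by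
  refine le_trans ?_ (le_degreeLE 𝒜 n.zero_le)
  rw [Submodule.one_le]
  exact SetLike.GradedOne.one_mem (A := 𝒜)

theorem degreeLE_mul_le (m n : ℕ) : degreeLE 𝒜 m * degreeLE 𝒜 n ≤ degreeLE 𝒜 (m + n) := by
  rw [degreeLE, degreeLE, Submodule.iSup_mul]
  refine iSup_le fun i => ?_
  rw [Submodule.iSup_mul]
  refine iSup_le fun hi => ?_
  rw [Submodule.mul_iSup]
  refine iSup_le fun j => ?_
  rw [Submodule.mul_iSup]
  refine iSup_le fun hj => ?_
  rw [Submodule.mul_le]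
  intro a ha b hb
  rw [Finset.mem_range] at hi hj
  exact le_degreeLE 𝒜 (by omega : i + j ≤ m + n) (SetLike.mul_mem_graded ha hb)

theorem pow_le_degreeLE {V : Submodule K A} {r : ℕ} (hV : V ≤ degreeLE 𝒜 r) (n : ℕ) :
    V ^ n ≤ degreeLE 𝒜 (r * n) := by
  induction n with
  | zero => rw [pow_zero]; exact one_le_degreeLE 𝒜 _
  | succ n ih =>
    rw [pow_succ, Nat.mul_succ]
    exact (mul_le_mul' ih hV).trans (degreeLE_mul_le 𝒜 _ _)

theorem exists_mem_degreeLE (a : A) : ∃ n, a ∈ degreeLE 𝒜 n := by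
  classical
  refine ⟨(DirectSum.decompose 𝒜 a).support.sup id, ?_⟩
  rw [← DirectSum.sum_support_decompose 𝒜 a]
  refine sum_mem fun i hi => le_degreeLE 𝒜 ?_ (DirectSum.decompose 𝒜 a i).2
  have : (DirectSum.decompose 𝒜 (∑ i ∈ (DirectSum.decompose 𝒜 a).support,
      (DirectSum.decompose 𝒜 a i : A))) = DirectSum.decompose 𝒜 a := by
    rw [DirectSum.sum_support_decompose]
  rw [this]
  exact Finset.le_sup (f := id) hi

theorem exists_le_degreeLE {V : Submodule K A} (hV : V.FG) : ∃ n, V ≤ degreeLE 𝒜 n := by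
  obtain ⟨s, rfl⟩ := hV
  choose f hf using exists_mem_degreeLE 𝒜
  refine ⟨s.sup f, Submodule.span_le.2 fun a ha => ?_⟩
  exact degreeLE_mono 𝒜 (Finset.le_sup ha) (hf a)

variable {𝒜}

theorem finite_degreeLE (hf : IsLocallyFinite 𝒜) (n : ℕ) : Module.Finite K (degreeLE 𝒜 n) := by
  have : ∀ i, Module.Finite K (𝒜 i) := hf
  rw [degreeLE, ← Finset.sup_eq_iSup]
  exact Submodule.finiteDimensional_finset_sup _ _

theorem finrank_degreeLE (hf : IsLocallyFinite 𝒜) (n : ℕ) :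
    Module.finrank K (degreeLE 𝒜 n) = ∑ i ∈ Finset.range (n + 1), Module.finrank K (𝒜 i) := by
  induction n with
  | zero =>
    rw [degreeLE, zero_add, Finset.range_one, Finset.iSup_singleton, Finset.sum_singleton]
  | succ n ih =>
    have : ∀ i, Module.Finite K (𝒜 i) := hf
    have := finite_degreeLE hf n
    have h1 : degreeLE 𝒜 (n + 1) = 𝒜 (n + 1) ⊔ degreeLE 𝒜 n := by
      rw [degreeLE, Finset.range_add_one, Finset.iSup_insert]
      rfl
    have h2 : Disjoint (𝒜 (n + 1)) (degreeLE 𝒜 n) :=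
      (DirectSum.Decomposition.isInternal 𝒜).submodule_iSupIndep.disjoint_biSup
        (y := Finset.range (n + 1)) (by simp)
    have h3 := Submodule.finrank_sup_add_finrank_inf_eq (𝒜 (n + 1)) (degreeLE 𝒜 n)
    rw [h2.eq_bot, finrank_bot, add_zero] at h3
    rw [h1, h3, ih, Finset.sum_range_succ _ (n + 1), add_comm]

theorem iSup_pow_one_eq (h : IsGeneratedInDegreeOne 𝒜) (n : ℕ) :
    ⨆ i ∈ Finset.range (n + 1), 𝒜 1 ^ i = degreeLE 𝒜 n := by
  simp only [degreeLE, ← component_eq_pow h]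

theorem iSup_pow_le_degreeLE {V : Submodule K A} {r : ℕ} (hV : V ≤ degreeLE 𝒜 r) (n : ℕ) :
    ⨆ i ∈ Finset.range (n + 1), V ^ i ≤ degreeLE 𝒜 (r * n) := by
  refine iSup₂_le fun i hi => (pow_le_degreeLE 𝒜 hV i).trans (degreeLE_mono 𝒜 ?_)
  rw [Finset.mem_range] at hi
  exact Nat.mul_le_mul_left r (by omega)

theorem gkDim_nonneg : 0 ≤ gkDim K A := by
  refine le_iSup₂_of_le ⊥ Submodule.fg_bot ?_
  refine le_limsup_of_frequently_le (Eventually.frequently (Eventually.of_forall fun n => ?_))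
    (by isBoundedDefault)
  exact EReal.coe_nonneg.2 (div_nonneg (Real.log_natCast_nonneg _) (Real.log_natCast_nonneg _))

/-- A finite-dimensional `V` lies in degrees at most some `r`, so `V⁰ + ⋯ + Vⁿ` lies in degrees at
most `r * n`. This rescaling affects only the constant, which disappears after division by `log n`.
-/
theorem gkDim_le (hc : IsConnectedGraded 𝒜) (hf : IsLocallyFinite 𝒜) {c : ℝ} {m : ℕ}
    (h : ∀ n : ℕ, ((∑ i ∈ Finset.range (n + 1), Module.finrank K (𝒜 i) : ℕ) : ℝ) ≤
      c * (n + 1) ^ m) : gkDim K A ≤ m := by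
  have hc0 : 0 ≤ c := by
    have := (Nat.cast_nonneg _).trans (h 0)
    simpa using this
  refine iSup₂_le fun V hV => ?_
  obtain ⟨r, hr⟩ := exists_le_degreeLE 𝒜 hV
  -- From `r * n + 1 ≤ (r + 1) * n`; the `c + 1` keeps `D` positive, so that its logarithm can be
  -- split off.
  set D : ℝ := (c + 1) * (r + 1) ^ m with hD
  have hD0 : 0 < D := by positivity
  have hlim : Tendsto (fun n : ℕ => ((Real.log D / Real.log n + m : ℝ) : EReal)) atTop
      (𝓝 ((m : ℝ) : EReal)) := by
    refine (continuous_coe_real_ereal.tendsto _).comp ?_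
    have h1 : Tendsto (fun n : ℕ => Real.log n) atTop atTop :=
      Real.tendsto_log_atTop.comp tendsto_natCast_atTop_atTop
    simpa using (h1.const_div_atTop (Real.log D)).add_const (m : ℝ)
  have hm : ((m : ℝ) : EReal) = (m : EReal) := rfl
  rw [← hm, ← hlim.limsup_eq]
  refine limsup_le_limsup ?_ (by isBoundedDefault) (by isBoundedDefault)
  filter_upwards [eventually_ge_atTop 2] with n hn
  have hn1 : (1 : ℝ) < n := by exact_mod_cast (by omega : 1 < n)
  have hlog : 0 < Real.log n := Real.log_pos hn1
  rw [EReal.coe_le_coe_iff, div_add' _ _ _ hlog.ne', div_le_div_iff_of_pos_right hlog,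
    ← Real.log_pow, ← Real.log_mul hD0.ne' (by positivity)]
  have hfin := finite_degreeLE hf (r * n)
  have hle : Module.finrank K (⨆ i ∈ Finset.range (n + 1), V ^ i : Submodule K A) ≤
      Module.finrank K (degreeLE 𝒜 (r * n)) :=
    Submodule.finrank_mono (iSup_pow_le_degreeLE hr n)
  have hpos : 0 < Module.finrank K (⨆ i ∈ Finset.range (n + 1), V ^ i : Submodule K A) := by
    have := hc.nontrivial
    have := Submodule.finiteDimensional_of_le (iSup_pow_le_degreeLE hr n)
    refine Submodule.one_le_finrank_iff.2 fun hbot => ?_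
    have h1 : (1 : Submodule K A) ≤ ⨆ i ∈ Finset.range (n + 1), V ^ i :=
      le_iSup₂_of_le 0 (by simp) (by rw [pow_zero])
    rw [hbot, Submodule.one_le, Submodule.mem_bot] at h1
    exact one_ne_zero h1
  refine Real.log_le_log (by exact_mod_cast hpos) ?_
  rw [finrank_degreeLE hf] at hle
  refine (Nat.cast_le.2 hle).trans ((h (r * n)).trans ?_)
  rw [hD, mul_assoc, ← mul_pow]
  gcongr
  · linarith
  · push_cast
    nlinarith

/-- For `V = A₁` the space `V⁰ + ⋯ + Vⁿ` is exactly the part of degree at most `n`, so a bound on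
the limsup becomes one on the partial sums of the Hilbert function. -/
theorem sum_finrank_le_rpow (hc : IsConnectedGraded 𝒜) (hf : IsLocallyFinite 𝒜)
    (h1 : IsGeneratedInDegreeOne 𝒜) {s : ℝ} (hs : limsup (fun n : ℕ =>
      ((Real.log (Module.finrank K (⨆ i ∈ Finset.range (n + 1), 𝒜 1 ^ i : Submodule K A)) /
        Real.log n : ℝ) : EReal)) atTop < s) :
    ∀ᶠ n : ℕ in atTop,
      ((∑ i ∈ Finset.range (n + 1), Module.finrank K (𝒜 i) : ℕ) : ℝ) ≤ (n : ℝ) ^ s := by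
  filter_upwards [eventually_lt_of_limsup_lt hs, eventually_ge_atTop 2] with n hn hn2
  rw [EReal.coe_lt_coe_iff, iSup_pow_one_eq h1, finrank_degreeLE hf] at hn
  have hn1 : (1 : ℝ) < n := by exact_mod_cast (by omega : 1 < n)
  have hpos : 0 < ∑ i ∈ Finset.range (n + 1), Module.finrank K (𝒜 i) := by
    refine lt_of_lt_of_le ?_ (Finset.single_le_sum (f := fun i => Module.finrank K (𝒜 i))
      (fun _ _ => Nat.zero_le _) (Finset.mem_range.2 n.succ_pos))
    have := ResolutionStage.hilbertFun_zero hc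
    rw [hilbertFun, ← Nat.cast_zero, intComponent_natCast] at this
    rw [this]
    exact one_pos
  rw [div_lt_iff₀ (Real.log_pos hn1), ← Real.log_rpow (by linarith)] at hn
  exact ((Real.log_lt_log_iff (by exact_mod_cast hpos) (by positivity)).1 hn).le

end GKDimension

/-! ### The dimension is the multiplicity of the zero `1` of `p`. -/

theorem theorem2p4 {K : Type v} {A : Type u} [Field K] [Ring A] [Algebra K A]
    (𝒜 : ℕ → Submodule K A) [GradedAlgebra 𝒜] (d : ℕ) (hA : IsArtinSchelterRegular 𝒜 d) :
    ∃ m : ℕ, gkDim K A = m ∧ m ≡ d [MOD 2] := by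
  have hc := hA.connected
  have hf := hA.locallyFinite
  have h1 := hA.generatedInDegreeOne
  obtain ⟨p, M, k, hM, hp, hr⟩ := hA.exists_polynomial
  have hfg : (𝒜 1).FG := by
    have := hf 1
    exact Module.Finite.iff_fg.1 this
  have hle := le_iSup₂ (f := fun (V : Submodule K A) (_ : V.FG) => Filter.limsup
      (fun n : ℕ =>
        ((Real.log (Module.finrank K (⨆ i ∈ Finset.range (n + 1), V ^ i : Submodule K A)) /
          Real.log n : ℝ) : EReal))
      Filter.atTop) (𝒜 1) hfg
  change _ ≤ gkDim K A at hle
  -- Finiteness of the dimension enters here: it gives convergence of `H` on the open unit disc.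
  have hgrowth : ∃ c : ℕ, ∀ᶠ n in Filter.atTop, Module.finrank K (𝒜 n) ≤ n ^ c := by
    obtain ⟨s, hs, -⟩ := EReal.lt_iff_exists_real_btwn.1 (hle.trans_lt hA.gkDim_lt_top)
    refine ⟨⌈s⌉₊, ?_⟩
    filter_upwards [sum_finrank_le_rpow hc hf h1 hs, Filter.eventually_ge_atTop 1] with n hn hn1
    have h2 : Module.finrank K (𝒜 n) ≤ ∑ i ∈ Finset.range (n + 1), Module.finrank K (𝒜 i) :=
      Finset.single_le_sum (f := fun i => Module.finrank K (𝒜 i))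
        (fun _ _ => Nat.zero_le _) (Finset.self_mem_range_succ n)
    have h3 : (n : ℝ) ^ s ≤ (n : ℝ) ^ (⌈s⌉₊ : ℝ) :=
      Real.rpow_le_rpow_of_exponent_le (by exact_mod_cast hn1) (Nat.le_ceil s)
    rw [Real.rpow_natCast] at h3
    exact_mod_cast (Nat.cast_le.2 h2).trans (hn.trans h3)
  obtain ⟨c, hcgrowth⟩ := hgrowth
  have hs : ∀ r : ℝ, 0 ≤ r → r < 1 → Summable fun n => (Module.finrank K (𝒜 n) : ℝ) * r ^ n :=
    fun r h0 h1 => summable_mul_pow_of_le_pow hcgrowth h0 h1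
  obtain ⟨N, hN, hdvd⟩ := dvd_one_sub_X_pow_pow hp hs hM hr
  obtain ⟨C, -, hC⟩ := exists_sum_le_mul_pow hp hN hdvd
  have hp0 : p ≠ 0 := by
    rintro rfl
    have := coeff_zero_eq_one hp
    simp at this
  refine ⟨_, le_antisymm (gkDim_le hc hf hC) ?_, modEq_rootMultiplicity hp0 hM hr⟩
  -- A real `s` strictly between the dimension and the multiplicity would bound the partial sums by
  -- `n ^ s`, too slow for the order of the pole at `1`.
  by_contra! hlt
  obtain ⟨s, hs1, hs2⟩ := EReal.lt_iff_exists_real_btwn.1 hlt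
  have hs0 : 0 ≤ s := EReal.coe_nonneg.1 (gkDim_nonneg.trans hs1.le)
  refine not_eventually_sum_le_rpow hp hs hs0 ?_ (sum_finrank_le_rpow hc hf h1 (hle.trans_lt hs1))
  exact_mod_cast hs2
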